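/- Let $n\ge 1$ and let $D_n=\langle \mu,\tau \mid \mu^n=\tau^2=1,\ \tau\mu=\mu^{-1}\tau\rangle$ be the dihedral group of order $2n$. Let $\pi:D_n\to U(n)$ be a projective unitary representation, i.e. for all $g,h$ the matrix $\pi(gh)$ equals $\pi(g)\pi(h)$ up to a unimodular scalar. Let $v\in\mathbb C^n$ be a unit vector and let $\Phi=D_nv$ be the $n\times 2n$ matrix with columns $\pi(g)v$, for $g=1,\mu,\dots,\mu^{n-1},\tau,\mu\tau,\dots,\mu^{n-1}\tau$ in this order. Call $\Phi$ strict if there are a unitary $U$ and a homomorphism $\rho:D_n\to U(n)$ such that, for every $g$, $U\pi(g)U^*$ equals $\rho(g)$ up to a unimodular scalar; otherwise call $\Phi$ genuinely projective. Call $\Phi$ regular if $\pi(1)v,\pi(\mu)v,\dots,\pi(\mu^{n-1})v$ is a basis of $\mathbb C^n$. An $\mathrm{ETF}(2n,n)$ is an equiangular tight frame of $2n$ unit vectors in $\mathbb C^n$. Two $n\times 2n$ matrices $\Phi,\Psi$ are switching equivalent if $\Psi=U\Phi\Pi^*$ with $U$ unitary and $\Pi$ a product of a unimodular diagonal matrix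 and a permutation matrix. A skew Hadamard matrix of order $m$ is a $\pm1$ matrix $H$ with $HH^\top=mI$ and $H+H^\top=2I$. A real $n\times n$ matrix with first row $(v_0,\dots,v_{n-1})$ is circulant if its $(i,j)$ entry is $v_{j-i}$ for $j\ge i$ and $v_{n+j-i}$ for $j<i$, and negacirculant if its $(i,j)$ entry is $v_{j-i}$ for $j\ge i$ and $-v_{n+j-i}$ for $j<i$. Theorem. Let $\Phi=D_nv$ be a strict (resp. genuinely projective) dihedral configuration. Then $\Phi$ is a regular $\mathrm{ETF}(2n,n)$ if and only if there exist circulant (resp. negacirculant) matrices $P,Q$ such that $$H=\begin{bmatrix}P&Q\\-Q^\top&P^\top\end{bmatrix}$$ is a skew Hadamard matrix and, up to switching equivalence (that is, for some $\Psi$ switching equivalent to $\Phi$ in place of $\Phi$), $$\Psi^*\Psi=I_{2n}+\frac1{\sqrt{2n-1}}\begin{bmatrix}i(P-I_n)&Q\\Q^\top&i(P^\top-I_n)\end{bmatrix}.$$ -/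

import Mathlib

open scoped Matrix

/-! ### Configurations, frames and switching equivalence

A configuration of vectors indexed by `N` in `ℂ^d` is the matrix `Φ : Matrix d N ℂ` whose columns
are the vectors. -/

section Configurations

variable {d N : Type*} [Fintype d] [DecidableEq d] [Fintype N] [DecidableEq N]

/-- The `j`-th vector of a configuration, as an element of the Hilbert space `ℂ^d`. -/
def frameVec (Φ : Matrix d N ℂ) (j : N) : EuclideanSpace ℂ d := WithLp.toLp 2 (Φ.col j)

/-- `Φ` is a tight frame: its two frame bounds coincide. -/
def IsTightFrame (Φ : Matrix d N ℂ) : Prop :=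
  ∃ A : ℝ, 0 < A ∧
    ∀ x : EuclideanSpace ℂ d, ∑ j, ‖inner ℂ x (frameVec Φ j)‖ ^ 2 = A * ‖x‖ ^ 2

/-- `Φ` is an equiangular tight frame of unit vectors. -/
def IsETF (Φ : Matrix d N ℂ) : Prop :=
  (∀ j, ‖frameVec Φ j‖ = 1) ∧ IsTightFrame Φ ∧
    ∃ c : ℝ, ∀ i j, i ≠ j → ‖inner ℂ (frameVec Φ i) (frameVec Φ j)‖ = c

/-- Phase monomial matrices: products of a diagonal matrix with unimodular diagonal and a
permutation matrix. -/
def IsPhaseMonomial (M : Matrix N N ℂ) : Prop :=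
  ∃ (c : N → ℂ) (σ : Equiv.Perm N), (∀ i, ‖c i‖ = 1) ∧
    M = Matrix.diagonal c * σ.permMatrix ℂ

/-- Switching equivalence of configurations: unitary motions, reorderings and changes of phase. -/
def SwitchingEquiv (Φ Ψ : Matrix d N ℂ) : Prop :=
  ∃ M : Matrix N N ℂ, IsPhaseMonomial M ∧
    ∃ U ∈ Matrix.unitaryGroup d ℂ, Ψ = U * Φ * Mᴴ

end Configurations

/-! ### Projective unitary representations -/

section Representations

variable {G : Type*} [Group G] {d : Type*} [Fintype d] [DecidableEq d]

/-- Equality up to a unimodular scalar. -/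
def ProjEq (A B : Matrix d d ℂ) : Prop := ∃ α : ℂ, ‖α‖ = 1 ∧ A = α • B

/-- `π` is a projective unitary representation. -/
def IsProjRep (π : G → Matrix.unitaryGroup d ℂ) : Prop :=
  ∀ g h : G, ProjEq (π (g * h) : Matrix d d ℂ) ((π g : Matrix d d ℂ) * (π h : Matrix d d ℂ))

/-- Equivalence of projective unitary representations. -/
def ProjRepEquiv (π π' : G → Matrix.unitaryGroup d ℂ) : Prop :=
  ∃ U : Matrix.unitaryGroup d ℂ, ∀ g : G,
    ProjEq ((U : Matrix d d ℂ) * (π g : Matrix d d ℂ) * (U : Matrix d d ℂ)ᴴ)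
      (π' g : Matrix d d ℂ)

/-- `π` is equivalent to a strict representation, i.e. to a homomorphism into the unitary group. -/
def IsEquivStrict (π : G → Matrix.unitaryGroup d ℂ) : Prop :=
  ∃ ρ : G →* Matrix.unitaryGroup d ℂ, ProjRepEquiv π ρ

end Representations

/-! ### Dihedral configurations -/

section Dihedral

variable {n : ℕ}

/-- The elements of the dihedral group in the order
`1, μ, …, μ^(n-1), τ, μτ, …, μ^(n-1)τ`, where `μ = r 1` and `τ = sr 0`. -/
def dihedralElt : Fin n ⊕ Fin n → DihedralGroup n :=
  Sum.elim (fun i => DihedralGroup.r 1 ^ (i : ℕ))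
    (fun i => DihedralGroup.r 1 ^ (i : ℕ) * DihedralGroup.sr 0)

/-- The dihedral configuration `D_n v`: its columns are the vectors `π(g) v`. -/
def dihedralConfig (π : DihedralGroup n → Matrix.unitaryGroup (Fin n) ℂ)
    (v : EuclideanSpace ℂ (Fin n)) : Matrix (Fin n) (Fin n ⊕ Fin n) ℂ :=
  Matrix.of fun i k => ((π (dihedralElt k) : Matrix (Fin n) (Fin n) ℂ) *ᵥ v.ofLp) i

/-- Regularity of the configuration `D_n v`: its vectors at `1, μ, …, μ^(n-1)` form a basis. -/
def IsRegularConfig (Φ : Matrix (Fin n) (Fin n ⊕ Fin n) ℂ) : Prop :=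
  LinearIndependent ℂ (fun i : Fin n => frameVec Φ (Sum.inl i)) ∧
    Submodule.span ℂ (Set.range fun i : Fin n => frameVec Φ (Sum.inl i)) = ⊤

end Dihedral

/-! ### Structured matrices -/

section Structured

/-- The entries depend only on the difference of the indices mod `n`. -/
def IsCirculant {n : ℕ} (A : Matrix (Fin n) (Fin n) ℝ) : Prop :=
  ∃ v : Fin n → ℝ, A = Matrix.circulant v

/-- Subtraction in `Fin n` is mod `n`: `j - i` is the residue `n + j - i` when `j < i`. -/
def IsNegacirculant {n : ℕ} (A : Matrix (Fin n) (Fin n) ℝ) : Prop :=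
  ∃ v : Fin n → ℝ, ∀ i j, A i j = if i ≤ j then v (j - i) else - v (j - i)

/-- Skew Hadamard matrices: real Hadamard matrices `H` with `H + Hᵀ = 2 I`. -/
def IsSkewHadamard {m : Type*} [Fintype m] [DecidableEq m] (H : Matrix m m ℝ) : Prop :=
  H.IsHadamard ∧ H + Hᵀ = (2 : ℝ) • (1 : Matrix m m ℝ)

/-- The complex matrix with the given real entries. -/
def toComplex {m k : Type*} (A : Matrix m k ℝ) : Matrix m k ℂ := A.map fun x => (x : ℂ)

/-- `I + (2n-1)^(-1/2) [i(P - I), Q; Qᵀ, i(Pᵀ - I)]`. -/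
noncomputable def gramOfBlocks {n : ℕ} (P Q : Matrix (Fin n) (Fin n) ℝ) :
    Matrix (Fin n ⊕ Fin n) (Fin n ⊕ Fin n) ℂ :=
  1 + ((1 / Real.sqrt (2 * (n : ℝ) - 1) : ℝ) : ℂ) •
    Matrix.fromBlocks (Complex.I • (toComplex P - 1)) (toComplex Q)
      (toComplex Q)ᵀ (Complex.I • ((toComplex P)ᵀ - 1))

end Structured

/-! After a change of phases, $\pi$ is governed by unitaries $u,t$ with $u^n=\varepsilon=\pm1$ and
$t^2=(tu)^2=1$; the value $\varepsilon=1$ gives a strict representation, so a genuinely projective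
one has $\varepsilon=-1$. Phases affect neither side of the equivalence, and the Gram matrix becomes
$\begin{bmatrix}F&R\\R^\top&F^\top\end{bmatrix}$, where $F,R$ have entries $f(j-i)$, $g(j-i)$ with
$f(m)=\langle v,u^mv\rangle$, $g(m)=\langle v,u^mtv\rangle$. Both functions pick up the factor
$\varepsilon$ under $m\mapsto m+n$, so these matrices are circulant or negacirculant and commute.
Moreover $F$ is Hermitian, and $R$ is real because each $u^mt$ is a Hermitian involution
(`IsDihedralPair.gram_eq`, `IsDihedralPair.coeff_mul_im`).

For an ETF the Gram matrix $G$ satisfies $G^2=2G$. Together with invertibility of $F$, which is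
regularity, this gives $(F+F^\top-2)(2-F)=0$; a trace computation then makes the off-diagonal
entries of $F$ imaginary (`re_eq_of_gram`). Rescaling by $\sqrt{2n-1}$ yields signs, and $G^2=2G$
becomes the Hadamard identity.

Conversely, the prescribed Gram matrix attains the Welch bound, so $\Phi$ is an ETF. Regularity is
subtler, since switching may mix the two halves of the columns. Triple products survive switching up
to relabelling, and they force the off-diagonal entries of $F$ to be imaginary. If $F$ were
singular, a vanishing eigenvalue would produce a square root of $-(2n-1)$ in $\mathbb Z[z]$ with
$z^{2n}=1$. For $n>1$ the Hadamard order $2n$ is divisible by 4, so $2n-1\equiv3\pmod 4$ is prime to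
$2n$, and no such root exists (`sq_ne_neg_natCast_of_mem_adjoin`). -/

/-! ### Square roots in rings of cyclotomic integers -/

section Arithmetic

/-- Modulo $p$ the map $x\mapsto x^{p^m}$ is a ring endomorphism. It fixes integers by Fermat and
$\omega$ by assumption, hence all of $\mathbb Z[\omega]$. -/
theorem exists_prime_dvd_pow_sub_self {ω : ℂ} {p m : ℕ} (hp : p.Prime) (hω : ω ^ p ^ m = ω)
    {x : ℂ} (hx : x ∈ Algebra.adjoin ℤ {ω}) :
    ∃ y ∈ Algebra.adjoin ℤ {ω}, x ^ p ^ m = x + p * y := by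
  induction hx using Algebra.adjoin_induction with
  | mem x hx =>
    obtain rfl : x = ω := by simpa using hx
    exact ⟨0, zero_mem _, by simp [hω]⟩
  | algebraMap k =>
    have : Fact p.Prime := ⟨hp⟩
    have h : ((p : ℕ) : ℤ) ∣ k ^ p ^ m - k := by
      rw [← ZMod.intCast_zmod_eq_zero_iff_dvd]
      push_cast
      rw [ZMod.pow_card_pow, sub_self]
    obtain ⟨y, hy⟩ := h
    refine ⟨algebraMap ℤ ℂ y, Subalgebra.algebraMap_mem _ _, ?_⟩
    have h2 : k ^ p ^ m = k + p * y := by linarith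
    simp only [algebraMap_int_eq, eq_intCast]
    exact_mod_cast congrArg (Int.cast : ℤ → ℂ) h2
  | add x y hx hy ihx ihy =>
    obtain ⟨a, ha, hxa⟩ := ihx
    obtain ⟨b, hb, hyb⟩ := ihy
    obtain ⟨r, hr⟩ := exists_add_pow_prime_pow_eq hp
      (⟨x, hx⟩ : Algebra.adjoin ℤ {ω}) ⟨y, hy⟩ m
    have hr' := congrArg (Subtype.val) hr
    push_cast at hr'
    refine ⟨a + b + x * y * r, add_mem (add_mem ha hb) (mul_mem (mul_mem hx hy) r.2), ?_⟩
    rw [hr', hxa, hyb]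
    ring
  | mul x y hx hy ihx ihy =>
    obtain ⟨a, ha, hxa⟩ := ihx
    obtain ⟨b, hb, hyb⟩ := ihy
    refine ⟨a * y + x * b + p * a * b, ?_, by rw [mul_pow, hxa, hyb]; ring⟩
    exact add_mem (add_mem (mul_mem ha hy) (mul_mem hx hb))
      (mul_mem (mul_mem (natCast_mem _ _) ha) hb)

/-- This is the absence of ramification at $p$: with $m=\varphi(N)$ the Frobenius power fixes
$\omega$, so $t\equiv t^{p^m}$ modulo $p$, and the right side is a multiple of $t^2$. -/
theorem exists_eq_prime_mul_of_sq {ω : ℂ} {p N : ℕ} (hp : p.Prime) (hpN : p.Coprime N)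
    (hN : 0 < N) (hω : ω ^ N = 1) {t y : ℂ} (ht : t ∈ Algebra.adjoin ℤ {ω})
    (hy : y ∈ Algebra.adjoin ℤ {ω}) (h : t ^ 2 = p * y) :
    ∃ s ∈ Algebra.adjoin ℤ {ω}, t = p * s := by
  have hmod : p ^ N.totient ≡ 1 [MOD N] := Nat.ModEq.pow_totient hpN
  have hpos : 0 < N.totient := Nat.totient_pos.2 hN
  have h2 : 2 ≤ p ^ N.totient :=
    hp.two_le.trans (Nat.le_self_pow hpos.ne' p)
  have hω' : ω ^ p ^ N.totient = ω := by
    obtain ⟨k, hk⟩ := (Nat.modEq_iff_dvd' (by omega)).1 hmod.symm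
    have : p ^ N.totient = N * k + 1 := by omega
    rw [this, pow_succ, pow_mul, hω, one_pow, one_mul]
  obtain ⟨z, hz, hz'⟩ := exists_prime_dvd_pow_sub_self hp hω' ht
  refine ⟨y * t ^ (p ^ N.totient - 2) - z, sub_mem (mul_mem hy (pow_mem ht _)) hz, ?_⟩
  have : t ^ p ^ N.totient = t ^ 2 * t ^ (p ^ N.totient - 2) := by
    rw [← pow_add]; congr 1; omega
  rw [this, h] at hz'
  linear_combination -hz'

/-- Descent on $M$: a prime $p\mid M$ divides $t$, which forces $p^2\mid M$, and $t/p$ is a square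
root of $-M/p^2$. The residue 3 modulo 4 persists, so $M$ never reaches 1. -/
theorem sq_ne_neg_natCast_of_mem_adjoin {ω : ℂ} {N : ℕ} (hN : 0 < N) (hω : ω ^ N = 1) (M : ℕ)
    (hMN : M.Coprime N) (hM : M % 4 = 3) (t : ℂ) (ht : t ∈ Algebra.adjoin ℤ {ω}) :
    t ^ 2 ≠ -(M : ℂ) := by
  induction M using Nat.strong_induction_on generalizing t with
  | _ M ih =>
  intro h
  have hM1 : M ≠ 1 := by omega
  have hp := Nat.minFac_prime hM1
  set p := M.minFac with hpdef
  obtain ⟨u, hu⟩ := Nat.minFac_dvd M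
  rw [← hpdef] at hu
  have hpN : p.Coprime N := Nat.Coprime.coprime_dvd_left (Nat.minFac_dvd M) hMN
  have hp0 : (p : ℂ) ≠ 0 := by exact_mod_cast hp.ne_zero
  obtain ⟨s, hs, rfl⟩ := exists_eq_prime_mul_of_sq hp hpN hN hω ht
    (y := -(u : ℂ)) (neg_mem (natCast_mem _ _)) (by rw [h, hu]; push_cast; ring)
  have hsu : (p : ℂ) * s ^ 2 = -(u : ℂ) := by
    apply mul_left_cancel₀ hp0
    rw [hu] at h
    push_cast at h
    linear_combination h
  have hωi : IsIntegral ℤ ω := ⟨Polynomial.X ^ N - 1, Polynomial.monic_X_pow_sub_C _ hN.ne', by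
    simp [hω]⟩
  have hsi : IsIntegral ℤ (s ^ 2) := by
    refine IsIntegral.pow ?_ 2
    exact adjoin_le_integralClosure hωi hs
  -- The number $s^2=-u/p$ is rational and integral over $\mathbb Z$, hence an integer, so $p\mid
  -- u$.
  have hq : s ^ 2 = algebraMap ℚ ℂ (-(u : ℚ) / p) := by
    simp only [eq_ratCast]
    push_cast
    rw [eq_div_iff hp0]
    linear_combination hsu
  rw [hq] at hsi
  have hqi : IsIntegral ℤ (-(u : ℚ) / p) :=
    (isIntegral_algebraMap_iff (algebraMap ℚ ℂ).injective).1 hsi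
  obtain ⟨k, hk⟩ := IsIntegrallyClosed.isIntegral_iff.1 hqi
  have hp0' : (p : ℚ) ≠ 0 := by exact_mod_cast hp.ne_zero
  have hk2 : (k * p : ℤ) = -(u : ℤ) := by
    rw [eq_div_iff hp0'] at hk
    simp only [algebraMap_int_eq, eq_intCast] at hk
    exact_mod_cast hk
  have hpu : p ∣ u := by
    have : (p : ℤ) ∣ (u : ℤ) := ⟨-k, by linarith⟩
    exact_mod_cast this
  obtain ⟨w, rfl⟩ := hpu
  have hw0 : 0 < w := by
    rcases Nat.eq_zero_or_pos w with rfl | h0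
    · simp at hu; omega
    · exact h0
  have hodd : p % 2 = 1 := by
    rcases hp.eq_two_or_odd with h2 | h2
    · rw [h2] at hu; omega
    · exact h2
  have hp4 : (p * p) % 4 = 1 := by
    rcases (by omega : p % 4 = 1 ∨ p % 4 = 3) with h4 | h4 <;> simp [Nat.mul_mod, h4]
  refine ih w ?_ ?_ ?_ s hs ?_
  · rw [hu]
    have := hp.two_le
    nlinarith [Nat.mul_le_mul this this]
  · exact Nat.Coprime.coprime_dvd_left ⟨p * p, by rw [hu]; ring⟩ hMN
  · rw [hu, ← mul_assoc, Nat.mul_mod, hp4] at hM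
    omega
  · apply mul_left_cancel₀ hp0
    rw [hsu]; push_cast; ring

end Arithmetic

/-! ### Frames and Gram matrices -/

section Gram

variable {d N : Type*} [Fintype d]

theorem inner_frameVec (Φ : Matrix d N ℂ) (i j : N) :
    inner ℂ (frameVec Φ i) (frameVec Φ j) = (Φᴴ * Φ) i j := by
  simp [frameVec, EuclideanSpace.inner_eq_star_dotProduct, Matrix.mul_apply, dotProduct,
    mul_comm]

theorem norm_frameVec_eq_one_iff (Φ : Matrix d N ℂ) (j : N) :
    ‖frameVec Φ j‖ = 1 ↔ (Φᴴ * Φ) j j = 1 := by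
  rw [← inner_frameVec, inner_self_eq_norm_sq_to_K]
  constructor
  · intro h
    simp [h]
  · intro h
    have h2 : ‖frameVec Φ j‖ ^ 2 = 1 := Complex.ofReal_injective (by push_cast; exact h)
    exact (pow_eq_one_iff_of_nonneg (norm_nonneg _) two_ne_zero).1 h2

theorem sum_norm_inner_frameVec_sq [DecidableEq d] [Fintype N] (Φ : Matrix d N ℂ) (x : EuclideanSpace ℂ d) :
    ((∑ j, ‖inner ℂ x (frameVec Φ j)‖ ^ 2 : ℝ) : ℂ) =
      inner ℂ x (Matrix.toEuclideanLin (Φ * Φᴴ) x) := by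
  have h : ∀ j, inner ℂ x (frameVec Φ j) = (star x.ofLp ᵥ* Φ) j := by
    intro j
    simp [frameVec, EuclideanSpace.inner_eq_star_dotProduct, Matrix.vecMul, dotProduct,
      mul_comm]
  have h2 : inner ℂ x (Matrix.toEuclideanLin (Φ * Φᴴ) x) =
      (star x.ofLp ᵥ* Φ) ⬝ᵥ star (star x.ofLp ᵥ* Φ) := by
    rw [EuclideanSpace.inner_eq_star_dotProduct, dotProduct_comm, Matrix.toLpLin_apply,
      Matrix.star_vecMul, star_star, ← Matrix.mulVec_mulVec, Matrix.dotProduct_mulVec]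
  rw [h2]
  push_cast
  refine Finset.sum_congr rfl fun j _ => ?_
  rw [h, Pi.star_apply, Complex.star_def, Complex.mul_conj']

/-- Over $\mathbb C$ an operator with vanishing quadratic form is zero, by polarization. -/
theorem mul_conjTranspose_eq_of_tight [DecidableEq d] [Fintype N] {Φ : Matrix d N ℂ} {A : ℝ}
    (h : ∀ x : EuclideanSpace ℂ d, ∑ j, ‖inner ℂ x (frameVec Φ j)‖ ^ 2 = A * ‖x‖ ^ 2) :
    Φ * Φᴴ = (A : ℂ) • 1 := by
  rw [← sub_eq_zero]
  apply (Matrix.toEuclideanLin (𝕜 := ℂ) (m := d) (n := d)).injective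
  rw [map_zero]
  apply inner_map_self_eq_zero (V := EuclideanSpace ℂ d) _ |>.1
  intro x
  rw [← inner_conj_symm, map_sub, map_smul]
  simp only [LinearMap.sub_apply, inner_sub_right, ← sum_norm_inner_frameVec_sq, h,
    LinearMap.smul_apply, Matrix.toLpLin_one, LinearMap.id_apply, inner_smul_right,
    inner_self_eq_norm_sq_to_K]
  simp

theorem tight_of_mul_conjTranspose_eq [DecidableEq d] [Fintype N] {Φ : Matrix d N ℂ} {A : ℝ}
    (h : Φ * Φᴴ = (A : ℂ) • 1) (x : EuclideanSpace ℂ d) :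
    ∑ j, ‖inner ℂ x (frameVec Φ j)‖ ^ 2 = A * ‖x‖ ^ 2 := by
  have := sum_norm_inner_frameVec_sq Φ x
  rw [h, map_smul, LinearMap.smul_apply, Matrix.toLpLin_one, LinearMap.id_apply,
    inner_smul_right, inner_self_eq_norm_sq_to_K] at this
  exact Complex.ofReal_injective (by rw [this]; push_cast; rfl)

theorem trace_gram_sq [Fintype N] (Φ : Matrix d N ℂ) :
    (Φᴴ * Φ * (Φᴴ * Φ)).trace = ∑ i, ∑ j, ((‖(Φᴴ * Φ) i j‖ ^ 2 : ℝ) : ℂ) := by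
  have hG : (Φᴴ * Φ)ᴴ = Φᴴ * Φ := by simp
  simp only [Matrix.trace, Matrix.diag_apply]
  refine Finset.sum_congr rfl fun i _ => ?_
  rw [Matrix.mul_apply]
  refine Finset.sum_congr rfl fun j _ => ?_
  nth_rewrite 2 [← hG]
  rw [Matrix.conjTranspose_apply, Complex.star_def, Complex.mul_conj']
  push_cast
  rfl

variable {n : ℕ} {Φ : Matrix (Fin n) (Fin n ⊕ Fin n) ℂ}

theorem trace_gram_sq_of_equiangular {c : ℝ} (h1 : ∀ j, (Φᴴ * Φ) j j = 1)
    (hc : ∀ i j, i ≠ j → ‖(Φᴴ * Φ) i j‖ = c) :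
    (Φᴴ * Φ * (Φᴴ * Φ)).trace = (2 * n * (1 + (2 * n - 1) * c ^ 2) : ℂ) := by
  rw [trace_gram_sq]
  have : ∀ i : Fin n ⊕ Fin n, ∑ j, ((‖(Φᴴ * Φ) i j‖ ^ 2 : ℝ) : ℂ) = 1 + (2 * n - 1) * c ^ 2 := by
    intro i
    have hj : ∀ j, ((‖(Φᴴ * Φ) i j‖ ^ 2 : ℝ) : ℂ) =
        (c : ℂ) ^ 2 + if i = j then 1 - (c : ℂ) ^ 2 else 0 := by
      intro j
      split_ifs with hij
      · subst hij
        simp [h1]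
      · simp [hc i j hij]
    simp only [hj, Finset.sum_add_distrib, Finset.sum_const, Finset.sum_ite_eq, Finset.mem_univ,
      if_true, Finset.card_univ, Fintype.card_sum, Fintype.card_fin, nsmul_eq_mul]
    push_cast
    ring
  rw [Finset.sum_congr rfl fun i _ => this i]
  simp only [Finset.sum_const, Finset.card_univ, Fintype.card_sum, Fintype.card_fin, nsmul_eq_mul]
  push_cast
  ring

theorem trace_gram (h1 : ∀ j, (Φᴴ * Φ) j j = 1) : (Φᴴ * Φ).trace = 2 * n := by
  simp [Matrix.trace, h1]
  ring

/-- A tight frame of `2n` unit vectors in dimension `n` has frame bound `2`. -/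
theorem IsETF.mul_conjTranspose (hn : 1 ≤ n) (h : IsETF Φ) : Φ * Φᴴ = (2 : ℂ) • 1 := by
  obtain ⟨h1, ⟨A, -, hA⟩, -⟩ := h
  have h2 := mul_conjTranspose_eq_of_tight hA
  have h3 := trace_gram fun j => (norm_frameVec_eq_one_iff Φ j).1 (h1 j)
  rw [Matrix.trace_mul_comm, h2, Matrix.trace_smul, Matrix.trace_one, smul_eq_mul,
    Fintype.card_fin] at h3
  have hn' : (n : ℂ) ≠ 0 := by exact_mod_cast (by omega : n ≠ 0)
  rw [h2, mul_right_cancel₀ hn' h3]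

open scoped ComplexOrder in
/-- Equiangular tight frames are the configurations of unit vectors that attain the Welch bound. -/
theorem isETF_iff (hn : 1 ≤ n) : IsETF Φ ↔ (∀ j, (Φᴴ * Φ) j j = 1) ∧
    ∀ i j, i ≠ j → ‖(Φᴴ * Φ) i j‖ = 1 / Real.sqrt (2 * (n : ℝ) - 1) := by
  have hn0 : (n : ℂ) ≠ 0 := by exact_mod_cast (by omega : n ≠ 0)
  have hn1 : (1 : ℝ) ≤ n := by exact_mod_cast hn
  have hpos : (0 : ℝ) < 2 * n - 1 := by linarith
  constructor
  · intro h
    have hB := h.mul_conjTranspose hn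
    obtain ⟨h1, -, c, hc⟩ := h
    have h1' := fun j => (norm_frameVec_eq_one_iff Φ j).1 (h1 j)
    refine ⟨h1', fun i j hij => ?_⟩
    have hc' : ∀ i j, i ≠ j → ‖(Φᴴ * Φ) i j‖ = c := fun i j hij => by
      rw [← inner_frameVec]; exact hc i j hij
    have ht := trace_gram_sq_of_equiangular h1' hc'
    have hG : Φᴴ * Φ * (Φᴴ * Φ) = (2 : ℂ) • (Φᴴ * Φ) := by
      rw [Matrix.mul_assoc, ← Matrix.mul_assoc Φ, hB]
      simp
    rw [hG, Matrix.trace_smul, trace_gram h1', smul_eq_mul] at ht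
    -- Comparison of $\operatorname{tr}G^2$ with $2\operatorname{tr}G=4n$ determines the common
    -- modulus $c$.
    have h2 : (2 : ℂ) = 1 + (2 * n - 1) * c ^ 2 := by
      apply mul_left_cancel₀ (mul_ne_zero two_ne_zero hn0)
      linear_combination ht
    have h3 : (2 : ℝ) = 1 + (2 * n - 1) * c ^ 2 := by exact_mod_cast h2
    rw [hc' i j hij]
    have hc0 : 0 ≤ c := hc' i j hij ▸ norm_nonneg _
    rw [eq_div_iff (Real.sqrt_pos.2 hpos).ne']
    have : (c * Real.sqrt (2 * n - 1)) ^ 2 = 1 := by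
      rw [mul_pow, Real.sq_sqrt hpos.le]; linarith
    exact (pow_eq_one_iff_of_nonneg (mul_nonneg hc0 (Real.sqrt_nonneg _)) two_ne_zero).1 this
  · rintro ⟨h1, hc⟩
    refine ⟨fun j => (norm_frameVec_eq_one_iff Φ j).2 (h1 j),
      ⟨2, two_pos, tight_of_mul_conjTranspose_eq ?_⟩, 1 / Real.sqrt (2 * (n : ℝ) - 1),
      fun i j hij => by rw [inner_frameVec]; exact hc i j hij⟩
    have ht := trace_gram_sq_of_equiangular h1 hc
    have hsq : ((1 / Real.sqrt (2 * (n : ℝ) - 1) : ℝ) : ℂ) ^ 2 * (2 * n - 1) = 1 := by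
      have : (1 / Real.sqrt (2 * (n : ℝ) - 1)) ^ 2 * (2 * n - 1) = 1 := by
        rw [div_pow, Real.sq_sqrt hpos.le]; field_simp
      exact_mod_cast this
    -- Tightness follows from a vanishing Frobenius norm:
    -- $\|\Phi\Phi^*-2I\|^2=\operatorname{tr}G^2-4\operatorname{tr}G+4n=4n-8n+4n=0$.
    rw [← sub_eq_zero, ← Matrix.trace_conjTranspose_mul_self_eq_zero_iff]
    have hBH : (Φ * Φᴴ - ((2 : ℝ) : ℂ) • (1 : Matrix (Fin n) (Fin n) ℂ))ᴴ =
        Φ * Φᴴ - (2 : ℂ) • 1 := by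
      simp
    rw [hBH]
    have hexp : (Φ * Φᴴ - (2 : ℂ) • 1) * (Φ * Φᴴ - ((2 : ℝ) : ℂ) • (1 : Matrix (Fin n) (Fin n) ℂ))
        = Φ * (Φᴴ * Φ * Φᴴ) - (4 : ℂ) • (Φ * Φᴴ) + (4 : ℂ) • 1 := by
      simp only [Matrix.sub_mul, Matrix.mul_sub, Matrix.smul_mul, Matrix.mul_smul, Matrix.one_mul,
        Matrix.mul_one, Matrix.mul_assoc, Complex.ofReal_ofNat]
      module
    rw [hexp, Matrix.trace_add, Matrix.trace_sub, Matrix.trace_smul, Matrix.trace_smul,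
      Matrix.trace_mul_comm Φ, Matrix.trace_mul_comm Φ, Matrix.mul_assoc (Φᴴ * Φ), ht,
      trace_gram h1, Matrix.trace_one, Fintype.card_fin, smul_eq_mul, smul_eq_mul]
    linear_combination (2 * n : ℂ) * hsq

theorem isRegularConfig_iff : IsRegularConfig Φ ↔ IsUnit (Φᴴ * Φ).toBlocks₁₁ := by
  have hB : (Φᴴ * Φ).toBlocks₁₁ = Φ.toCols₁ᴴ * Φ.toCols₁ := by
    ext i j
    simp [Matrix.toBlocks₁₁, Matrix.mul_apply, Matrix.toCols₁]
  have hli : LinearIndependent ℂ (fun i : Fin n => frameVec Φ (Sum.inl i)) ↔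
      IsUnit Φ.toCols₁ := by
    rw [← Matrix.linearIndependent_cols_iff_isUnit,
      ← LinearMap.linearIndependent_iff (WithLp.linearEquiv 2 ℂ (Fin n → ℂ)).toLinearMap
        (LinearEquiv.ker _)]
    rfl
  have hu : IsUnit (Φ.toCols₁ᴴ * Φ.toCols₁) ↔ IsUnit Φ.toCols₁ := by
    simp only [Matrix.isUnit_iff_isUnit_det, Matrix.det_mul, Matrix.det_conjTranspose,
      isUnit_iff_ne_zero, ne_eq, mul_eq_zero, star_eq_zero, or_self]
  rw [hB, hu, ← hli, IsRegularConfig]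
  refine ⟨fun h => h.1, fun h => ⟨h, ?_⟩⟩
  exact h.span_eq_top_of_card_eq_finrank' (by simp)

end Gram

/-! ### Quasi-periodic Toeplitz matrices -/

section Toeplitz

/-- `f` is multiplied by `ε` when its argument is increased by `n`. -/
def IsQuasiPeriodic {R : Type*} [Mul R] (n : ℕ) (ε : R) (f : ℤ → R) : Prop :=
  ∀ m, f (m + n) = ε * f m

/-- The `n × n` matrix whose `(i, j)` entry is `f (j - i)`. -/
def toeplitz {R : Type*} (n : ℕ) (f : ℤ → R) : Matrix (Fin n) (Fin n) R :=
  Matrix.of fun i j => f ((j : ℤ) - (i : ℤ))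

theorem toeplitz_apply {R : Type*} (n : ℕ) (f : ℤ → R) (i j : Fin n) :
    toeplitz n f i j = f ((j : ℤ) - (i : ℤ)) := rfl

/-- The sum runs over $\mathbb Z/n$, where $z\mapsto a-z$ is a bijection. -/
theorem sum_sub_eq_of_periodic {R : Type*} [AddCommMonoid R] {n : ℕ} {h : ℤ → R}
    (hper : Function.Periodic h (n : ℤ)) (a : ℤ) :
    ∑ k : Fin n, h (a - (k : ℤ)) = ∑ k : Fin n, h (k : ℤ) := by
  rcases Nat.eq_zero_or_pos n with rfl | hn
  · simp
  have : NeZero n := ⟨hn.ne'⟩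
  have key : ∀ m : ℤ, h m = h (((m : ZMod n).val : ℕ) : ℤ) := by
    intro m
    rw [ZMod.val_intCast, Int.emod_def, mul_comm, ← smul_eq_mul, hper.sub_zsmul_eq]
  have hsum : ∀ H : ZMod n → R, ∑ k : Fin n, H ((k : ℕ) : ZMod n) = ∑ z : ZMod n, H z := by
    intro H
    refine Fintype.sum_equiv (ZMod.finEquiv n).toEquiv _ _ fun k => ?_
    congr 1
    obtain ⟨m, rfl⟩ : ∃ m, n = m + 1 := ⟨n - 1, by omega⟩
    exact Fin.cast_val_eq_self k
  have e1 : ∑ k : Fin n, h (a - (k : ℤ)) =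
      ∑ k : Fin n, (fun z : ZMod n => h (((a : ZMod n) - z).val : ℤ)) ((k : ℕ) : ZMod n) := by
    refine Finset.sum_congr rfl fun k _ => ?_
    rw [key]
    push_cast
    rfl
  have e2 : ∑ k : Fin n, h (k : ℤ) =
      ∑ k : Fin n, (fun z : ZMod n => h (z.val : ℤ)) ((k : ℕ) : ZMod n) := by
    refine Finset.sum_congr rfl fun k _ => ?_
    rw [key]
    push_cast
    rfl
  rw [e1, e2, hsum fun z => h (((a : ZMod n) - z).val : ℤ), hsum fun z => h (z.val : ℤ)]
  exact Fintype.sum_equiv (Equiv.subLeft (a : ZMod n)) _ _ fun z => rfl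

section CommRing

variable {R : Type*} [CommRing R] {n : ℕ} {ε : R} {f g : ℤ → R}

theorem IsQuasiPeriodic.comp_neg (hε : ε * ε = 1) (hf : IsQuasiPeriodic n ε f) :
    IsQuasiPeriodic n ε fun m => f (-m) := by
  intro m
  have := hf (-(m + n))
  rw [show -(m + (n : ℤ)) + n = -m by ring] at this
  simp only [this, ← mul_assoc, hε, one_mul]

theorem transpose_toeplitz {R : Type*} (n : ℕ) (f : ℤ → R) : (toeplitz n f)ᵀ = toeplitz n fun m => f (-m) := by
  ext i j
  simp [toeplitz_apply]

/-- In $\sum_m f(m-i)g(j-m)$ the multipliers of $f$ and $g$ balance, so the summand is $n$-periodic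
in $m$. The reflection $m\mapsto i+j-m$ then exchanges the roles of $f$ and $g$. -/
theorem toeplitz_mul_comm (hf : IsQuasiPeriodic n ε f)
    (hg : IsQuasiPeriodic n ε g) : toeplitz n f * toeplitz n g = toeplitz n g * toeplitz n f := by
  ext i j
  simp only [Matrix.mul_apply, toeplitz_apply]
  have hper : Function.Periodic (fun m : ℤ => f (m - (i : ℤ)) * g ((j : ℤ) - m)) (n : ℤ) := by
    intro m
    have h1 : f (m + n - (i : ℤ)) = ε * f (m - i) := by rw [← hf]; congr 1; ring
    have h2 : g ((j : ℤ) - m) = ε * g ((j : ℤ) - (m + n)) := by rw [← hg]; congr 1; ring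
    simp only [h1, h2]
    ring
  rw [← sum_sub_eq_of_periodic hper ((i : ℤ) + (j : ℤ))]
  refine Finset.sum_congr rfl fun k _ => ?_
  rw [mul_comm]
  congr 2 <;> ring

end CommRing

variable {n : ℕ} {s : ℤ → ℝ}

theorem val_sub_eq {i j : Fin n} :
    (((j - i : Fin n) : ℕ) : ℤ) = if i ≤ j then (j : ℤ) - i else (j : ℤ) - i + n := by
  split_ifs with h
  · rw [Fin.sub_val_of_le h]
    have : (i : ℕ) ≤ j := h
    omega
  · have h' : j < i := not_le.1 h
    have h2 : (j : ℕ) < i := h'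
    rw [Fin.val_sub, Nat.mod_eq_of_lt] <;> omega

theorem IsQuasiPeriodic.apply_sub (hs : IsQuasiPeriodic n (-1) s) (i j : Fin n) :
    toeplitz n s i j =
      if i ≤ j then s ((j - i : Fin n) : ℕ) else -s ((j - i : Fin n) : ℕ) := by
  rw [toeplitz_apply]
  split_ifs with h
  · rw [val_sub_eq, if_pos h]
  · rw [val_sub_eq, if_neg h, hs]
    ring

theorem isNegacirculant_toeplitz (hs : IsQuasiPeriodic n (-1) s) :
    IsNegacirculant (toeplitz n s) :=
  ⟨fun k => s (k : ℕ), fun i j => hs.apply_sub i j⟩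

theorem isNegacirculant_one_add_toeplitz (hn : 1 ≤ n) (hs : IsQuasiPeriodic n (-1) s) :
    IsNegacirculant (1 + toeplitz n s) := by
  have : NeZero n := ⟨by omega⟩
  refine ⟨fun k => (if k = 0 then 1 else 0) + s (k : ℕ), fun i j => ?_⟩
  rw [Matrix.add_apply, hs.apply_sub, Matrix.one_apply]
  have e : i = j ↔ j - i = 0 := by rw [sub_eq_zero]; exact eq_comm
  by_cases h : i ≤ j
  · simp only [h, if_true, e]
  · have hne : j - i ≠ 0 := fun h0 => h (e.2 h0).le
    simp only [h, if_false, e, hne]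
    ring

theorem IsQuasiPeriodic.apply_sub_one (hs : IsQuasiPeriodic n 1 s) (i j : Fin n) :
    toeplitz n s i j = s ((j - i : Fin n) : ℕ) := by
  rw [toeplitz_apply, val_sub_eq]
  split_ifs with h
  · rfl
  · rw [hs, one_mul]

theorem isCirculant_toeplitz (hn : 1 ≤ n) (hs : IsQuasiPeriodic n 1 s) :
    IsCirculant (toeplitz n s) := by
  have : NeZero n := ⟨by omega⟩
  -- The sign reversal is needed because `Matrix.circulant v` has entries `v (i - j)`.
  refine ⟨fun k => s ((-k : Fin n) : ℕ), ?_⟩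
  ext i j
  rw [hs.apply_sub_one, Matrix.circulant_apply, neg_sub]

theorem isCirculant_one_add_toeplitz (hn : 1 ≤ n) (hs : IsQuasiPeriodic n 1 s) :
    IsCirculant (1 + toeplitz n s) := by
  have : NeZero n := ⟨by omega⟩
  obtain ⟨v, hv⟩ := isCirculant_toeplitz hn hs
  refine ⟨Pi.single 0 1 + v, ?_⟩
  rw [hv, Matrix.circulant_add, Matrix.circulant_single_one]

end Toeplitz

/-! ### From Gram matrices to skew Hadamard matrices -/

section Hadamard

variable {n : ℕ}

/-- The real part of a circulant-like Hermitian block of a tight Gram matrix is the identity. -/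
theorem re_eq_of_gram {F Q : Matrix (Fin n) (Fin n) ℂ} (hF : Fᴴ = F) (hdiag : ∀ i, F i i = 1)
    (hu : IsUnit F) (h11 : F * F + Q * Qᵀ = (2 : ℂ) • F) (h12 : F * Q + Q * Fᵀ = (2 : ℂ) • Q)
    (hQF : Q * Fᵀ = Fᵀ * Q) (i j : Fin n) (hij : i ≠ j) : (F i j).re = 0 := by
  have h1 : (F + Fᵀ - (2 : ℂ) • 1) * Q = 0 := by
    rw [Matrix.sub_mul, Matrix.add_mul, ← hQF, h12]
    simp
  -- Since $(2-F)F=QQ^\top$ and the first factor annihilates $Q$, the product vanishes after right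
  -- multiplication by the invertible $F$.
  have h2 : (F + Fᵀ - (2 : ℂ) • 1) * ((2 : ℂ) • 1 - F) = 0 := by
    apply hu.mul_right_cancel
    have : ((2 : ℂ) • 1 - F) * F = Q * Qᵀ := by
      rw [Matrix.sub_mul, Matrix.smul_mul, Matrix.one_mul, ← h11]
      abel
    rw [Matrix.mul_assoc, this, ← Matrix.mul_assoc, h1]
    simp
  have h3 := congrArg Matrix.trace h2
  have hconj : ∀ i j, F j i = star (F i j) := fun i j => by
    rw [← Matrix.conjTranspose_apply, hF]
  set A := F - 1 with hA
  have hAd : ∀ i, A i i = 0 := fun i => by simp [hA, hdiag]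
  have hAconj : ∀ i j, A j i = star (A i j) := fun i j => by
    simp only [hA, Matrix.sub_apply, hconj i j, star_sub, Matrix.one_apply, eq_comm (a := j)]
    split_ifs <;> simp
  have hexp : (F + Fᵀ - (2 : ℂ) • 1) * ((2 : ℂ) • 1 - F) = A + Aᵀ - (A * A + Aᵀ * A) := by
    have e1 : F + Fᵀ - (2 : ℂ) • 1 = A + Aᵀ := by
      rw [hA, Matrix.transpose_sub, Matrix.transpose_one]; module
    have e2 : (2 : ℂ) • 1 - F = 1 - A := by rw [hA]; module
    rw [e1, e2, Matrix.mul_sub, Matrix.mul_one, Matrix.add_mul]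
  have htr : A.trace = 0 := by simp [Matrix.trace, hAd]
  rw [hexp, Matrix.trace_sub, Matrix.trace_add, Matrix.trace_transpose, htr, Matrix.trace_add] at h3
  -- With $z=A_{ji}$ and $A_{ij}=\bar z$, each summand of $\operatorname{tr}(A^2+A^\top A)$ is
  -- $|z|^2+z^2$, whose real part is $2(\operatorname{Re}z)^2$.
  have h4 : ∑ i, ∑ j, 2 * (A j i).re ^ 2 = 0 := by
    have h5 : ∑ i, ∑ j, (A i j * A j i + A j i * A j i) = 0 := by
      simp only [Finset.sum_add_distrib]
      simp only [Matrix.trace, Matrix.diag_apply, Matrix.mul_apply, Matrix.transpose_apply,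
        Matrix.zero_apply, Finset.sum_const_zero] at h3
      linear_combination -h3
    have h6 := congrArg Complex.re h5
    rw [Complex.re_sum, Complex.zero_re] at h6
    rw [← h6]
    refine Finset.sum_congr rfl fun i _ => ?_
    rw [Complex.re_sum]
    refine Finset.sum_congr rfl fun j _ => ?_
    rw [hAconj j i]
    simp
    ring
  have h7 := (Finset.sum_eq_zero_iff_of_nonneg
    (fun i _ => Finset.sum_nonneg fun j _ => by positivity)).1 h4 j (Finset.mem_univ _)
  have h8 := (Finset.sum_eq_zero_iff_of_nonneg
    (fun i _ => by positivity)).1 h7 i (Finset.mem_univ _)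
  have h9 : (A i j).re = 0 := by simpa using h8
  simpa [hA, Matrix.one_apply, hij] using h9

/-- In $HH^\top$ the off-diagonal blocks cancel by commutation, and the diagonal blocks equal
$I-S^2+QQ^\top=2nI$. -/
theorem isSkewHadamard_of_blocks {S Q : Matrix (Fin n) (Fin n) ℝ} (hn : 1 ≤ n)
    (hS : Sᵀ = -S) (hSe : ∀ i j, i ≠ j → S i j = 1 ∨ S i j = -1)
    (hQe : ∀ i j, Q i j = 1 ∨ Q i j = -1) (hSQ : S * Q = Q * S) (hQQ : Qᵀ * Q = Q * Qᵀ)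
    (hsum : Q * Qᵀ - S * S = (2 * n - 1 : ℝ) • 1) :
    IsSkewHadamard (Matrix.fromBlocks (1 + S) Q (-Qᵀ) (1 + S)ᵀ) := by
  have hS0 : ∀ i, S i i = 0 := fun i => by
    have := congrFun (congrFun hS i) i
    simp only [Matrix.transpose_apply, Matrix.neg_apply] at this
    linarith
  have hPe : ∀ i j, (1 + S) i j = 1 ∨ (1 + S) i j = -1 := fun i j => by
    by_cases hij : i = j
    · subst hij; simp [hS0]
    · simpa [Matrix.one_apply, hij] using hSe i j hij
  have hu : ∀ x : ℝ, x = 1 ∨ x = -1 → x ∈ unitary ℝ := by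
    rintro x (rfl | rfl) <;> simp [Unitary.mem_iff]
  constructor
  · apply Matrix.IsHadamard.of_mul_conjTranspose
    · rintro (i | i) (j | j)
      · exact hu _ (hPe i j)
      · exact hu _ (hQe i j)
      · simp only [Matrix.fromBlocks_apply₂₁, Matrix.neg_apply, Matrix.transpose_apply]
        apply hu
        rcases hQe j i with h | h <;> simp [h]
      · exact hu _ (hPe j i)
    · have hQS' : S * Qᵀ = Qᵀ * S := by
        have := congrArg Matrix.transpose hSQ
        rw [Matrix.transpose_mul, Matrix.transpose_mul, hS] at this
        simpa using this.symm
      rw [Matrix.conjTranspose_eq_transpose_of_trivial, Matrix.fromBlocks_transpose,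
        Matrix.fromBlocks_multiply]
      simp only [Matrix.transpose_add, Matrix.transpose_one, Matrix.transpose_neg,
        Matrix.transpose_transpose, hS, Matrix.add_mul, Matrix.mul_add, Matrix.mul_neg,
        Matrix.neg_mul, Matrix.one_mul, Matrix.mul_one, neg_neg]
      have hcard : ((Fintype.card (Fin n ⊕ Fin n) : ℕ) : ℝ) = 2 * n := by
        simp; ring
      have hd : Q * Qᵀ = S * S + (2 * n - 1 : ℝ) • 1 := by rw [← hsum]; abel
      rw [hcard, ← Matrix.fromBlocks_one, Matrix.fromBlocks_smul, hQQ, hSQ, hQS', hd]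
      congr 1
      · module
      · simp
      · rw [smul_zero]; abel
      · module
    · refine isRegular_iff_ne_zero.2 ?_
      simp only [Fintype.card_sum, Fintype.card_fin, ne_eq, Nat.cast_eq_zero]
      omega
  · rw [Matrix.fromBlocks_transpose, Matrix.fromBlocks_add, ← Matrix.fromBlocks_one,
      Matrix.fromBlocks_smul]
    simp only [Matrix.transpose_add, Matrix.transpose_one, Matrix.transpose_neg,
      Matrix.transpose_transpose, hS]
    congr 1
    · module
    · simp
    · simp
    · module

theorem exists_isSkewHadamard_of_toeplitz_gram (hn : 1 ≤ n) {ε : ℝ} (hε : ε * ε = 1)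
    {f g : ℤ → ℂ} (hf : IsQuasiPeriodic n (ε : ℂ) f) (hg : IsQuasiPeriodic n (ε : ℂ) g)
    (hfstar : ∀ m, f (-m) = star (f m)) (hgreal : ∀ m, (g m).im = 0) (hf0 : f 0 = 1)
    (hfn : ∀ i j, i ≠ j → ‖toeplitz n f i j‖ = 1 / Real.sqrt (2 * (n : ℝ) - 1))
    (hgn : ∀ i j, ‖toeplitz n g i j‖ = 1 / Real.sqrt (2 * (n : ℝ) - 1))
    (h11 : toeplitz n f * toeplitz n f + toeplitz n g * (toeplitz n g)ᵀ = (2 : ℂ) • toeplitz n f)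
    (h12 : toeplitz n f * toeplitz n g + toeplitz n g * (toeplitz n f)ᵀ = (2 : ℂ) • toeplitz n g)
    (hu : IsUnit (toeplitz n f)) :
    ∃ s q : ℤ → ℝ, IsQuasiPeriodic n ε s ∧ IsQuasiPeriodic n ε q ∧
      IsSkewHadamard (Matrix.fromBlocks (1 + toeplitz n s) (toeplitz n q)
        (-(toeplitz n q)ᵀ) (1 + toeplitz n s)ᵀ) ∧
      Matrix.fromBlocks (toeplitz n f) (toeplitz n g) (toeplitz n g)ᵀ (toeplitz n f)ᵀ =
        gramOfBlocks (1 + toeplitz n s) (toeplitz n q) := by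
  have hn1 : (1 : ℝ) ≤ n := by exact_mod_cast hn
  have hpos : (0 : ℝ) < 2 * n - 1 := by linarith
  have hεC : (ε : ℂ) * ε = 1 := by exact_mod_cast hε
  set c : ℝ := 1 / Real.sqrt (2 * (n : ℝ) - 1) with hc
  have hc0 : 0 < c := by positivity
  have hc2 : c ^ 2 * (2 * n - 1) = 1 := by
    rw [hc, div_pow, Real.sq_sqrt hpos.le]; field_simp
  have hFH : (toeplitz n f)ᴴ = toeplitz n f := by
    ext i j
    rw [Matrix.conjTranspose_apply, toeplitz_apply, toeplitz_apply, ← hfstar]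
    congr 1
    ring
  have hre : ∀ i j, i ≠ j → (toeplitz n f i j).re = 0 :=
    re_eq_of_gram hFH (fun i => by simp [toeplitz_apply, hf0]) hu h11 h12
      (by rw [transpose_toeplitz]; exact toeplitz_mul_comm hg (hf.comp_neg hεC))
  let s : ℤ → ℝ := fun m => (f m).im / c
  let q : ℤ → ℝ := fun m => (g m).re / c
  have hs : IsQuasiPeriodic n ε s := fun m => by
    simp only [s, hf m, Complex.im_ofReal_mul]
    ring
  have hq : IsQuasiPeriodic n ε q := fun m => by
    simp only [q, hg m, Complex.re_ofReal_mul]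
    ring
  have hF : toeplitz n f = 1 + (c * Complex.I) • toComplex (toeplitz n s) := by
    ext i j
    by_cases hij : i = j
    · subst hij
      simp [toeplitz_apply, hf0, toComplex, s]
    · have h := hre i j hij
      rw [toeplitz_apply] at h
      simp only [Matrix.add_apply, Matrix.one_apply_ne hij, Matrix.smul_apply, toComplex,
        Matrix.map_apply, toeplitz_apply, s, smul_eq_mul]
      apply Complex.ext
      · simp [h]
      · simp
        field_simp
  have hQ : toeplitz n g = (c : ℂ) • toComplex (toeplitz n q) := by
    ext i j
    simp only [Matrix.smul_apply, toComplex, Matrix.map_apply, toeplitz_apply, q, smul_eq_mul]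
    apply Complex.ext
    · simp
      field_simp
    · simp [hgreal]
  have habs : ∀ x : ℝ, |x| = c → x / c = 1 ∨ x / c = -1 := by
    intro x hx
    rcases eq_or_eq_neg_of_abs_eq hx with h | h <;> rw [h]
    · left; field_simp
    · right; field_simp
  have hSe : ∀ i j, i ≠ j → toeplitz n s i j = 1 ∨ toeplitz n s i j = -1 := fun i j hij => by
    apply habs
    rw [← hfn i j hij, toeplitz_apply]
    exact Complex.abs_im_eq_norm.2 (hre i j hij)
  have hQe : ∀ i j, toeplitz n q i j = 1 ∨ toeplitz n q i j = -1 := fun i j => by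
    apply habs
    rw [← hgn i j, toeplitz_apply]
    exact Complex.abs_re_eq_norm.2 (hgreal _)
  have hST : (toeplitz n s)ᵀ = -toeplitz n s := by
    ext i j
    simp only [Matrix.transpose_apply, Matrix.neg_apply, toeplitz_apply, s]
    rw [← neg_sub (j : ℤ) (i : ℤ), hfstar]
    simp
    ring
  refine ⟨s, q, hs, hq, isSkewHadamard_of_blocks hn hST hSe hQe (toeplitz_mul_comm hs hq) ?_ ?_, ?_⟩
  · rw [transpose_toeplitz]
    exact toeplitz_mul_comm (hq.comp_neg hε) hq
  -- Substitution of $F=1+ciS$ and $R=cQ$ into $F^2+RR^\top=2F$ leaves $c^2(QQ^\top-S^2)=I$, and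
  -- $c^2=1/(2n-1)$.
  · have key : toComplex (toeplitz n q * (toeplitz n q)ᵀ - toeplitz n s * toeplitz n s) =
        toComplex ((2 * n - 1 : ℝ) • 1) := by
      have hmul : ∀ A B : Matrix (Fin n) (Fin n) ℝ,
          toComplex (A * B) = toComplex A * toComplex B := fun A B => by
        ext i j
        simp [toComplex, Matrix.mul_apply]
      have hsub : ∀ A B : Matrix (Fin n) (Fin n) ℝ,
          toComplex (A - B) = toComplex A - toComplex B := fun A B => by
        ext i j
        simp [toComplex]
      have hsm : toComplex ((2 * n - 1 : ℝ) • (1 : Matrix (Fin n) (Fin n) ℝ)) =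
          (2 * n - 1 : ℂ) • 1 := by
        ext i j
        simp only [toComplex, Matrix.map_apply, Matrix.smul_apply, Matrix.one_apply, smul_eq_mul]
        split_ifs <;> simp
      have htr : (toComplex (toeplitz n q))ᵀ = toComplex (toeplitz n q)ᵀ := rfl
      rw [hsub, hmul, hmul, hsm]
      rw [hF, hQ, Matrix.transpose_smul, htr] at h11
      simp only [Matrix.add_mul, Matrix.mul_add, Matrix.one_mul, Matrix.mul_one, Matrix.smul_mul,
        Matrix.mul_smul, smul_add, smul_smul] at h11
      have hc2' : (c : ℂ) ^ 2 * (2 * n - 1) = 1 := by exact_mod_cast hc2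
      have hcc : (c : ℂ) * c ≠ 0 := by
        have : (c : ℂ) ≠ 0 := by exact_mod_cast hc0.ne'
        exact mul_ne_zero this this
      have hII : (c * Complex.I) * (c * Complex.I) = -((c : ℂ) * c) := by
        linear_combination (c : ℂ) ^ 2 * Complex.I_sq
      rw [hII] at h11
      apply smul_right_injective _ hcc
      simp only [smul_sub (c * c : ℂ), smul_smul]
      rw [show (c : ℂ) * c * (2 * n - 1) = 1 by linear_combination hc2', one_smul]
      linear_combination (norm := module) h11
    ext i j
    have := congrFun (congrFun key i) j
    exact Complex.ofReal_injective this
  · have hP : toComplex (1 + toeplitz n s) - 1 = toComplex (toeplitz n s) := by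
      ext i j
      simp [toComplex, Matrix.one_apply]
      split_ifs <;> simp
    have hP' : (toComplex (1 + toeplitz n s))ᵀ - 1 = (toComplex (toeplitz n s))ᵀ := by
      rw [← hP]; simp
    rw [gramOfBlocks, hP, hP', hF, hQ, ← hc, ← Matrix.fromBlocks_one, Matrix.fromBlocks_smul,
      Matrix.fromBlocks_add]
    simp [smul_smul]

end Hadamard

/-! ### Normal forms of projective representations of dihedral groups -/

section ProjEq

variable {d : Type*} {A B C A' B' : Matrix d d ℂ}

theorem ProjEq.refl (A : Matrix d d ℂ) : ProjEq A A := ⟨1, by simp, by simp⟩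

theorem ProjEq.symm (h : ProjEq A B) : ProjEq B A := by
  obtain ⟨α, hα, rfl⟩ := h
  have h0 : α ≠ 0 := norm_ne_zero_iff.1 (by rw [hα]; exact one_ne_zero)
  exact ⟨α⁻¹, by simp [hα], by rw [smul_smul, inv_mul_cancel₀ h0, one_smul]⟩

theorem ProjEq.trans (h : ProjEq A B) (h' : ProjEq B C) : ProjEq A C := by
  obtain ⟨α, hα, rfl⟩ := h
  obtain ⟨β, hβ, rfl⟩ := h'
  exact ⟨α * β, by simp [hα, hβ], by rw [smul_smul]⟩

theorem projEq_smul {α : ℂ} (hα : ‖α‖ = 1) (A : Matrix d d ℂ) : ProjEq (α • A) A := ⟨α, hα, rfl⟩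

variable [Fintype d]

theorem ProjEq.mul (h : ProjEq A B) (h' : ProjEq A' B') : ProjEq (A * A') (B * B') := by
  obtain ⟨α, hα, rfl⟩ := h
  obtain ⟨β, hβ, rfl⟩ := h'
  exact ⟨α * β, by simp [hα, hβ], by rw [Matrix.smul_mul, Matrix.mul_smul, smul_smul]⟩

variable [DecidableEq d]

theorem ProjEq.pow (h : ProjEq A B) (k : ℕ) : ProjEq (A ^ k) (B ^ k) := by
  induction k with
  | zero => simpa using ProjEq.refl _
  | succ k ih => rw [pow_succ, pow_succ]; exact ih.mul h

theorem smul_mem_unitaryGroup {α : ℂ} (hα : ‖α‖ = 1) (hA : A ∈ Matrix.unitaryGroup d ℂ) :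
    α • A ∈ Matrix.unitaryGroup d ℂ := by
  rw [Matrix.mem_unitaryGroup_iff] at hA ⊢
  rw [star_smul, Matrix.smul_mul, Matrix.mul_smul, hA, smul_smul, Complex.star_def,
    Complex.mul_conj', hα]
  simp

end ProjEq

section ProjRep

variable {G : Type*} [Group G] {d : Type*} [Fintype d] [DecidableEq d]
  {π : G → Matrix.unitaryGroup d ℂ}

theorem IsProjRep.map_one (hπ : IsProjRep π) : ProjEq (π 1 : Matrix d d ℂ) 1 := by
  obtain ⟨α, hα, h⟩ := hπ 1 1
  rw [mul_one] at h
  have hu := Matrix.mem_unitaryGroup_iff.1 (π 1).2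
  have h2 : (1 : Matrix d d ℂ) = α • (π 1 : Matrix d d ℂ) := by
    calc (1 : Matrix d d ℂ) = (π 1 : Matrix d d ℂ) * star (π 1 : Matrix d d ℂ) := hu.symm
      _ = (α • ((π 1 : Matrix d d ℂ) * (π 1 : Matrix d d ℂ))) * star (π 1 : Matrix d d ℂ) := by
          rw [← h]
      _ = _ := by rw [Matrix.smul_mul, Matrix.mul_assoc, hu, Matrix.mul_one]
  exact ProjEq.symm ⟨α, hα, h2⟩

theorem IsProjRep.map_pow (hπ : IsProjRep π) (g : G) (k : ℕ) :
    ProjEq (π (g ^ k) : Matrix d d ℂ) ((π g : Matrix d d ℂ) ^ k) := by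
  induction k with
  | zero => simpa using hπ.map_one
  | succ k ih => rw [pow_succ, pow_succ]; exact (hπ _ _).trans (ih.mul (ProjEq.refl _))

end ProjRep

section Dihedral

/-- The homomorphism from the dihedral group given by a pair satisfying its relations. -/
def dihedralHom {G : Type*} [Group G] (n : ℕ) (u t : G) (hu : u ^ n = 1) (ht : t * t = 1)
    (htu : ∀ m : ℤ, t * u ^ m = u ^ (-m) * t) : DihedralGroup n →* G := by
  -- Since $u^n=1$, the choice of integer representatives of residues is immaterial.
  have hz : ∀ a b : ℤ, (a : ZMod n) = b → u ^ a = u ^ b := by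
    intro a b h
    obtain ⟨k, hk⟩ := (ZMod.intCast_eq_intCast_iff_dvd_sub a b n).1 h
    rw [show b = a + n * k by linarith, zpow_add, zpow_mul, zpow_natCast, hu, one_zpow, mul_one]
  refine MonoidHom.mk' (fun g => match g with
    | DihedralGroup.r i => u ^ (i.cast : ℤ)
    | DihedralGroup.sr i => t * u ^ (i.cast : ℤ)) ?_
  rintro (i | i) (j | j)
  · rw [DihedralGroup.r_mul_r]
    change u ^ ((i + j).cast : ℤ) = u ^ (i.cast : ℤ) * u ^ (j.cast : ℤ)
    rw [← zpow_add]
    exact hz _ _ (by simp)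
  · rw [DihedralGroup.r_mul_sr]
    change t * u ^ ((j - i).cast : ℤ) = u ^ (i.cast : ℤ) * (t * u ^ (j.cast : ℤ))
    rw [← mul_assoc, ← neg_neg (i.cast : ℤ), ← htu, mul_assoc, ← zpow_add]
    congr 1
    exact hz _ _ (by simp; ring)
  · rw [DihedralGroup.sr_mul_r]
    change t * u ^ ((i + j).cast : ℤ) = t * u ^ (i.cast : ℤ) * u ^ (j.cast : ℤ)
    rw [mul_assoc, ← zpow_add]
    congr 1
    exact hz _ _ (by simp)
  · rw [DihedralGroup.sr_mul_sr]
    change u ^ ((j - i).cast : ℤ) = t * u ^ (i.cast : ℤ) * (t * u ^ (j.cast : ℤ))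
    rw [htu, ← mul_assoc, mul_assoc (u ^ _), ht, mul_one, ← zpow_add]
    exact hz _ _ (by simp; ring)

theorem mul_zpow_of_mul_mul_mul_eq_one {G : Type*} [Group G] {u t : G} (ht : t * t = 1)
    (h : t * u * (t * u) = 1) (m : ℤ) : t * u ^ m = u ^ (-m) * t := by
  have ht' : t⁻¹ = t := inv_eq_of_mul_eq_one_right ht
  have h1 : t * u * t⁻¹ = u⁻¹ := by
    rw [ht']
    exact eq_inv_of_mul_eq_one_left (by rw [mul_assoc]; exact h)
  have h2 := conj_zpow (i := m) (a := t) (b := u)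
  rw [h1, inv_zpow'] at h2
  rw [h2, inv_mul_cancel_right]

variable {n : ℕ}

/-- A pair `u`, `t` of unitary matrices with `u ^ n = ε` and `(t u)² = t² = 1` that represents `π`
up to phases. -/
structure IsDihedralPair (π : DihedralGroup n → Matrix.unitaryGroup (Fin n) ℂ) (ε : ℝ)
    (u t : Matrix.unitaryGroup (Fin n) ℂ) : Prop where
  pow_eq : (u : Matrix (Fin n) (Fin n) ℂ) ^ n = (ε : ℂ) • 1
  mul_self : t * t = 1
  mul_zpow (m : ℤ) : t * u ^ m = u ^ (-m) * t
  projEq_r : ProjEq (π (DihedralGroup.r 1) : Matrix (Fin n) (Fin n) ℂ) u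
  projEq_sr : ProjEq (π (DihedralGroup.sr 0) : Matrix (Fin n) (Fin n) ℂ) t

variable {π : DihedralGroup n → Matrix.unitaryGroup (Fin n) ℂ}

theorem IsEquivStrict.exists_isDihedralPair (h : IsEquivStrict π) :
    ∃ u t, IsDihedralPair π 1 u t := by
  obtain ⟨ρ, W, hW⟩ := h
  let σ : DihedralGroup n →* Matrix.unitaryGroup (Fin n) ℂ :=
    (MulAut.conj W⁻¹).toMonoidHom.comp ρ
  have hWu : (W : Matrix (Fin n) (Fin n) ℂ)ᴴ * W = 1 := Matrix.mem_unitaryGroup_iff'.1 W.2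
  have hσ : ∀ g, ProjEq (π g : Matrix (Fin n) (Fin n) ℂ) (σ g) := by
    intro g
    have h1 := ((ProjEq.refl (W : Matrix (Fin n) (Fin n) ℂ)ᴴ).mul (hW g)).mul
      (ProjEq.refl (W : Matrix (Fin n) (Fin n) ℂ))
    have h2 : (W : Matrix (Fin n) (Fin n) ℂ)ᴴ * (W * π g * (W : Matrix (Fin n) (Fin n) ℂ)ᴴ) * W =
        π g := by
      rw [Matrix.mul_assoc (W : Matrix (Fin n) (Fin n) ℂ), ← Matrix.mul_assoc, hWu, Matrix.one_mul,
        Matrix.mul_assoc, hWu, Matrix.mul_one]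
    rw [h2] at h1
    have h3 : (σ g : Matrix (Fin n) (Fin n) ℂ) = (W : Matrix (Fin n) (Fin n) ℂ)ᴴ * ρ g * W := by
      simp [σ, Matrix.star_eq_conjTranspose]
    rwa [h3]
  refine ⟨σ (DihedralGroup.r 1), σ (DihedralGroup.sr 0), ?_, ?_, ?_, hσ _, hσ _⟩
  · have := map_pow σ (DihedralGroup.r 1) n
    rw [DihedralGroup.r_one_pow_n, map_one] at this
    have h2 := congrArg Subtype.val this
    simpa using h2.symm
  · rw [← map_mul, DihedralGroup.sr_mul_self, map_one]
  · intro m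
    rw [← map_zpow, ← map_zpow, ← map_mul, ← map_mul]
    simp

theorem exists_norm_one_pow_eq {α : ℂ} (hα : ‖α‖ = 1) {k : ℕ} (hk : 0 < k) :
    ∃ β : ℂ, ‖β‖ = 1 ∧ β ^ k = α := by
  obtain ⟨β, hβ⟩ := IsAlgClosed.exists_pow_nat_eq α hk
  refine ⟨β, ?_, hβ⟩
  rw [← hβ, norm_pow] at hα
  exact (pow_eq_one_iff_of_nonneg (norm_nonneg _) hk.ne').1 hα

theorem ProjEq.exists_smul_pow_eq_one {d : Type*} [Fintype d] [DecidableEq d] {A : Matrix d d ℂ}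
    {k : ℕ} (hk : 0 < k) (h : ProjEq (A ^ k) 1) : ∃ β : ℂ, ‖β‖ = 1 ∧ (β • A) ^ k = 1 := by
  obtain ⟨α, hα, hA⟩ := h
  have h0 : α ≠ 0 := norm_ne_zero_iff.1 (by rw [hα]; exact one_ne_zero)
  obtain ⟨β, hβ, hβα⟩ := exists_norm_one_pow_eq (α := α⁻¹) (by simp [hα]) hk
  exact ⟨β, hβ, by rw [smul_pow, hA, hβα, smul_smul, inv_mul_cancel₀ h0, one_smul]⟩

/-- The conjugate $XYX=lY^{-1}$ commutes with $Y$, so the $n$-th power of $(XYX)Y=l$ is $XY^nX\cdot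
Y^n=1$. -/
theorem pow_eq_one_of_mul_sq_eq_smul_one (hn : 1 ≤ n) {X Y : Matrix (Fin n) (Fin n) ℂ} {l : ℂ}
    (hX : X * X = 1) (hY : Y ^ n = 1) (hXY : (X * Y) ^ 2 = l • 1) : l ^ n = 1 := by
  have : NeZero n := ⟨by omega⟩
  have e1 : X * Y * X * Y = l • 1 := by rw [← hXY, sq, Matrix.mul_assoc (X * Y)]
  have hinv : ∀ k, (X * Y * X) ^ k = X * Y ^ k * X := by
    intro k
    induction k with
    | zero => rw [pow_zero, pow_zero, Matrix.mul_one, hX]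
    | succ k ih =>
      calc (X * Y * X) ^ (k + 1) = X * Y ^ k * (X * X) * Y * X := by
            rw [pow_succ, ih]; simp only [Matrix.mul_assoc]
        _ = _ := by rw [hX, pow_succ]; simp only [Matrix.mul_assoc, Matrix.one_mul]
  have hcomm : Commute (X * Y * X) Y := by
    have hYu : Y * Y ^ (n - 1) = 1 := by rw [← pow_succ', Nat.sub_add_cancel hn, hY]
    have e2 : X * Y * X = l • Y ^ (n - 1) := by
      calc X * Y * X = X * Y * X * Y * Y ^ (n - 1) := by
            rw [Matrix.mul_assoc (X * Y * X) Y, hYu, Matrix.mul_one]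
        _ = _ := by rw [e1, Matrix.smul_mul, Matrix.one_mul]
    rw [e2]
    exact (Commute.pow_self Y (n - 1)).smul_left l
  have e3 := hcomm.mul_pow n
  rw [e1, hinv, hY, Matrix.mul_one, Matrix.mul_one, hX, smul_pow, one_pow] at e3
  simpa using congrFun (congrFun e3 0) 0

theorem IsProjRep.exists_isDihedralPair (hn : 1 ≤ n) (hπ : IsProjRep π) :
    ∃ (ε : ℝ) (u t : Matrix.unitaryGroup (Fin n) ℂ), (ε = 1 ∨ ε = -1) ∧
      IsDihedralPair π ε u t := by
  have : NeZero n := ⟨by omega⟩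
  set A := (π (DihedralGroup.r 1) : Matrix (Fin n) (Fin n) ℂ) with hAdef
  set B := (π (DihedralGroup.sr 0) : Matrix (Fin n) (Fin n) ℂ) with hBdef
  have hA : ProjEq (A ^ n) 1 := by
    have := hπ.map_pow (DihedralGroup.r 1) n
    rw [DihedralGroup.r_one_pow_n] at this
    exact this.symm.trans hπ.map_one
  have hB : ProjEq (B ^ 2) 1 := by
    have := hπ.map_pow (DihedralGroup.sr 0) 2
    rw [sq, DihedralGroup.sr_mul_self] at this
    exact this.symm.trans hπ.map_one
  have hBA : ProjEq ((B * A) ^ 2) 1 := by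
    have h1 := hπ (DihedralGroup.sr 0) (DihedralGroup.r 1)
    rw [DihedralGroup.sr_mul_r] at h1
    have h2 := hπ.map_pow (DihedralGroup.sr (0 + 1)) 2
    rw [sq, DihedralGroup.sr_mul_self] at h2
    exact (h1.pow 2).symm.trans (h2.symm.trans hπ.map_one)
  obtain ⟨b, hb, hT⟩ := hB.exists_smul_pow_eq_one two_pos
  obtain ⟨a, ha, hU0⟩ := hA.exists_smul_pow_eq_one (by omega : 0 < n)
  have hTU0 : ProjEq (((b • B) * (a • A)) ^ 2) 1 :=
    (((projEq_smul hb B).mul (projEq_smul ha A)).pow 2).trans hBA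
  obtain ⟨l, hl, hTU⟩ := hTU0
  have hl0 : l ≠ 0 := norm_ne_zero_iff.1 (by rw [hl]; exact one_ne_zero)
  -- Scaling the rotation by $s$ with $s^2=l^{-1}$ makes $(tu)^2=1$. The price is $u^n=s^n$, which
  -- is $\pm1$ because $s^{2n}=l^{-n}=1$.
  obtain ⟨s, hs, hsl⟩ := exists_norm_one_pow_eq (α := l⁻¹) (by simp [hl]) two_pos
  have hln : l ^ n = 1 :=
    pow_eq_one_of_mul_sq_eq_smul_one hn ((sq (b • B)).symm.trans hT) hU0 hTU
  have hsn : s ^ n = 1 ∨ s ^ n = -1 := by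
    rw [← mul_self_eq_one_iff, ← sq, ← pow_mul, mul_comm, pow_mul, hsl, inv_pow, hln, inv_one]
  have hε : ∃ ε : ℝ, (ε = 1 ∨ ε = -1) ∧ s ^ n = (ε : ℂ) := by
    rcases hsn with h | h
    · exact ⟨1, Or.inl rfl, by simp [h]⟩
    · exact ⟨-1, Or.inr rfl, by simp [h]⟩
  obtain ⟨ε, hε, hsε⟩ := hε
  let u : Matrix.unitaryGroup (Fin n) ℂ :=
    ⟨s • (a • A), smul_mem_unitaryGroup hs (smul_mem_unitaryGroup ha (π _).2)⟩
  let t : Matrix.unitaryGroup (Fin n) ℂ := ⟨b • B, smul_mem_unitaryGroup hb (π _).2⟩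
  have htt : t * t = 1 := Subtype.ext ((sq (b • B)).symm.trans hT)
  have htu : t * u * (t * u) = 1 := by
    apply Subtype.ext
    change (b • B) * (s • (a • A)) * ((b • B) * (s • (a • A))) = 1
    rw [Matrix.mul_smul, Matrix.smul_mul, Matrix.mul_smul, ← sq ((b • B) * (a • A)), hTU, smul_smul,
      smul_smul, ← sq, hsl, inv_mul_cancel₀ hl0, one_smul]
  refine ⟨ε, u, t, hε, ?_, htt, mul_zpow_of_mul_mul_mul_eq_one htt htu, ?_, ?_⟩
  · change (s • (a • A)) ^ n = _
    rw [smul_pow, hU0, hsε]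
  · exact ((projEq_smul hs _).trans (projEq_smul ha A)).symm
  · exact (projEq_smul hb B).symm

theorem isEquivStrict_of_isDihedralPair (hn : 1 ≤ n) (hπ : IsProjRep π)
    {u t : Matrix.unitaryGroup (Fin n) ℂ} (h : IsDihedralPair π 1 u t) : IsEquivStrict π := by
  have : NeZero n := ⟨by omega⟩
  have hu : u ^ n = 1 := Subtype.ext (by simpa using h.pow_eq)
  refine ⟨dihedralHom n u t hu h.mul_self h.mul_zpow, 1, fun g => ?_⟩
  rw [OneMemClass.coe_one, Matrix.one_mul, Matrix.conjTranspose_one, Matrix.mul_one]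
  have hr : ∀ i : ZMod n, ProjEq (π (DihedralGroup.r i) : Matrix (Fin n) (Fin n) ℂ)
      (u ^ (i.cast : ℤ) : Matrix.unitaryGroup (Fin n) ℂ) := by
    intro i
    have h1 := (hπ.map_pow (DihedralGroup.r 1) i.val).trans (h.projEq_r.pow _)
    rw [DihedralGroup.r_one_pow, ZMod.natCast_zmod_val] at h1
    rw [← ZMod.natCast_val, zpow_natCast]
    exact h1
  rcases g with i | i
  · exact hr i
  · have h1 := (hπ (DihedralGroup.sr 0) (DihedralGroup.r i)).trans (h.projEq_sr.mul (hr i))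
    rw [DihedralGroup.sr_mul_r, zero_add] at h1
    exact h1

end Dihedral

/-! ### Gram matrices of dihedral configurations -/

section DihedralGram

variable {n : ℕ} {π : DihedralGroup n → Matrix.unitaryGroup (Fin n) ℂ} {ε : ℝ}
  {u t : Matrix.unitaryGroup (Fin n) ℂ} {v : EuclideanSpace ℂ (Fin n)}

/-- The unitary matrices `1, u, …, u^(n-1), t, ut, …, u^(n-1)t`. -/
def pairElt (u t : Matrix.unitaryGroup (Fin n) ℂ) : Fin n ⊕ Fin n → Matrix.unitaryGroup (Fin n) ℂ :=
  Sum.elim (fun i => u ^ (i : ℕ)) (fun i => u ^ (i : ℕ) * t)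

/-- The configuration of the vectors `v, uv, …, u^(n-1)v, tv, utv, …, u^(n-1)tv`. -/
def pairConfig (u t : Matrix.unitaryGroup (Fin n) ℂ) (v : EuclideanSpace ℂ (Fin n)) :
    Matrix (Fin n) (Fin n ⊕ Fin n) ℂ :=
  Matrix.of fun i k => ((pairElt u t k : Matrix (Fin n) (Fin n) ℂ) *ᵥ v.ofLp) i

/-- The diagonal matrix coefficient of `v` at `x`. -/
def coeff (v : EuclideanSpace ℂ (Fin n)) (x : Matrix.unitaryGroup (Fin n) ℂ) : ℂ :=
  star v.ofLp ⬝ᵥ ((x : Matrix (Fin n) (Fin n) ℂ) *ᵥ v.ofLp)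

theorem coeff_one (hv : ‖v‖ = 1) : coeff v 1 = 1 := by
  have h := inner_self_eq_norm_sq_to_K (𝕜 := ℂ) v
  rw [hv, EuclideanSpace.inner_eq_star_dotProduct, dotProduct_comm] at h
  simpa [coeff] using h

theorem coeff_inv (x : Matrix.unitaryGroup (Fin n) ℂ) : coeff v x⁻¹ = star (coeff v x) := by
  rw [coeff, coeff, ← Matrix.star_dotProduct, Matrix.star_mulVec, ← Matrix.dotProduct_mulVec]
  rfl

theorem pairConfig_gram_apply (k l : Fin n ⊕ Fin n) :
    ((pairConfig u t v)ᴴ * pairConfig u t v) k l = coeff v ((pairElt u t k)⁻¹ * pairElt u t l) := by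
  have : ((pairConfig u t v)ᴴ * pairConfig u t v) k l =
      star ((pairElt u t k : Matrix (Fin n) (Fin n) ℂ) *ᵥ v.ofLp) ⬝ᵥ
        ((pairElt u t l : Matrix (Fin n) (Fin n) ℂ) *ᵥ v.ofLp) := rfl
  rw [this, Matrix.star_mulVec, ← Matrix.dotProduct_mulVec, Matrix.mulVec_mulVec]
  rfl

/-- The relation $tu^m=u^{-m}t$ turns $(u^it)^{-1}u^j$ into $u^{i-j}t$ and $(u^it)^{-1}u^jt$ into
$u^{i-j}$, hence the transposes. -/
theorem IsDihedralPair.gram_eq (h : IsDihedralPair π ε u t) :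
    (pairConfig u t v)ᴴ * pairConfig u t v =
      Matrix.fromBlocks (toeplitz n fun m => coeff v (u ^ m)) (toeplitz n fun m => coeff v (u ^ m * t))
        (toeplitz n fun m => coeff v (u ^ m * t))ᵀ (toeplitz n fun m => coeff v (u ^ m))ᵀ := by
  have ht : t⁻¹ = t := inv_eq_of_mul_eq_one_right h.mul_self
  ext (i | i) (j | j) <;> rw [pairConfig_gram_apply]
  · simp only [pairElt, Sum.elim_inl, Matrix.fromBlocks_apply₁₁, toeplitz_apply]
    rw [← zpow_natCast, ← zpow_natCast, ← zpow_neg, ← zpow_add, neg_add_eq_sub]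
  · simp only [pairElt, Sum.elim_inl, Sum.elim_inr, Matrix.fromBlocks_apply₁₂, toeplitz_apply]
    rw [← zpow_natCast, ← zpow_natCast, ← zpow_neg, ← mul_assoc, ← zpow_add, neg_add_eq_sub]
  · simp only [pairElt, Sum.elim_inl, Sum.elim_inr, Matrix.fromBlocks_apply₂₁, toeplitz_apply,
      Matrix.transpose_apply]
    rw [← zpow_natCast, ← zpow_natCast, mul_inv_rev, ← zpow_neg, mul_assoc, ← zpow_add, ht,
      h.mul_zpow]
    congr 3
    ring
  · simp only [pairElt, Sum.elim_inr, Matrix.fromBlocks_apply₂₂, toeplitz_apply,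
      Matrix.transpose_apply]
    rw [← zpow_natCast, ← zpow_natCast, mul_inv_rev, ← zpow_neg, mul_assoc, ← mul_assoc (u ^ _),
      ← zpow_add, ht, ← mul_assoc, h.mul_zpow, mul_assoc, h.mul_self, mul_one]
    congr 2
    ring

theorem IsDihedralPair.isQuasiPeriodic (h : IsDihedralPair π ε u t)
    (x : Matrix.unitaryGroup (Fin n) ℂ) :
    IsQuasiPeriodic n (ε : ℂ) fun m => coeff v (u ^ m * x) := by
  intro m
  simp only [coeff]
  rw [zpow_add, zpow_natCast]
  push_cast
  rw [h.pow_eq, Matrix.mul_smul, Matrix.mul_one, Matrix.smul_mul, Matrix.smul_mulVec,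
    dotProduct_smul, smul_eq_mul]

/-- A reflection $u^mt$ is its own inverse, so a unitary one is Hermitian. -/
theorem IsDihedralPair.coeff_mul_im (h : IsDihedralPair π ε u t) (m : ℤ) :
    (coeff v (u ^ m * t)).im = 0 := by
  have ht : t⁻¹ = t := inv_eq_of_mul_eq_one_right h.mul_self
  have h1 : (u ^ m * t)⁻¹ = u ^ m * t := by
    rw [mul_inv_rev, ht, ← zpow_neg, h.mul_zpow, neg_neg]
  have h2 := coeff_inv (v := v) (u ^ m * t)
  rw [h1] at h2
  exact Complex.conj_eq_iff_im.1 h2.symm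

theorem IsDihedralPair.projEq (hπ : IsProjRep π) (h : IsDihedralPair π ε u t) (k : Fin n ⊕ Fin n) :
    ProjEq (π (dihedralElt k) : Matrix (Fin n) (Fin n) ℂ) (pairElt u t k) := by
  rcases k with i | i
  · exact (hπ.map_pow _ _).trans (h.projEq_r.pow _)
  · exact (hπ _ _).trans (((hπ.map_pow _ _).trans (h.projEq_r.pow _)).mul h.projEq_sr)

theorem IsDihedralPair.exists_phases (hπ : IsProjRep π) (h : IsDihedralPair π ε u t)
    (v : EuclideanSpace ℂ (Fin n)) : ∃ c : Fin n ⊕ Fin n → ℂ, (∀ k, ‖c k‖ = 1) ∧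
      dihedralConfig π v = pairConfig u t v * Matrix.diagonal c := by
  choose c hc hc' using h.projEq hπ
  refine ⟨c, hc, ?_⟩
  ext i k
  rw [Matrix.mul_diagonal, dihedralConfig, pairConfig, Matrix.of_apply, Matrix.of_apply, hc' k,
    Matrix.smul_mulVec]
  simp [mul_comm]

end DihedralGram

/-! ### Invariance under switching -/

section Switching

variable {n : ℕ} {d N : Type*} [Fintype d] [DecidableEq d] [Fintype N] [DecidableEq N]

theorem star_mul_self_of_norm_eq_one {c : ℂ} (hc : ‖c‖ = 1) : star c * c = 1 := by
  rw [Complex.star_def, Complex.conj_mul', hc]; simp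

theorem switchingEquiv_mul_diagonal (Φ : Matrix d N ℂ) {c : N → ℂ} (hc : ∀ k, ‖c k‖ = 1) :
    SwitchingEquiv (Φ * Matrix.diagonal c) Φ := by
  refine ⟨Matrix.diagonal c, ⟨c, 1, hc, by simp⟩, 1, one_mem _, ?_⟩
  rw [Matrix.one_mul, Matrix.mul_assoc, Matrix.diagonal_conjTranspose, Matrix.diagonal_mul_diagonal]
  have : (fun i => c i * (star c) i) = 1 := by
    funext i
    rw [mul_comm]
    exact star_mul_self_of_norm_eq_one (hc i)
  rw [this]
  simp

theorem SwitchingEquiv.of_mul_diagonal {Φ Ψ : Matrix d N ℂ} {c : N → ℂ} (hc : ∀ k, ‖c k‖ = 1)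
    (h : SwitchingEquiv (Φ * Matrix.diagonal c) Ψ) : SwitchingEquiv Φ Ψ := by
  obtain ⟨M, ⟨b, σ, hb, hM⟩, U, hU, rfl⟩ := h
  -- Moving the diagonal factor to the left of the permutation matrix evaluates it at `σ i`.
  refine ⟨M * Matrix.diagonal (star c), ⟨fun i => b i * star (c (σ i)), σ, fun i => ?_, ?_⟩,
    U, hU, ?_⟩
  · rw [norm_mul, norm_star, hb, hc, one_mul]
  · rw [hM]
    ext i j
    simp only [Matrix.mul_diagonal, Matrix.diagonal_mul, PEquiv.toMatrix_apply, Pi.star_apply,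
      Equiv.toPEquiv_apply, Option.mem_some_iff, mul_ite, mul_one, mul_zero, ite_mul, zero_mul]
    split_ifs with hij
    · rw [hij]
    · rfl
  · rw [Matrix.conjTranspose_mul, Matrix.diagonal_conjTranspose, star_star]
    simp only [Matrix.mul_assoc]

theorem SwitchingEquiv.exists_gram_apply {Φ Ψ : Matrix d N ℂ} (h : SwitchingEquiv Φ Ψ) :
    ∃ (c : N → ℂ) (σ : Equiv.Perm N), (∀ k, ‖c k‖ = 1) ∧
      ∀ i j, (Φᴴ * Φ) i j = star (c i) * c j * (Ψᴴ * Ψ) (σ i) (σ j) := by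
  obtain ⟨M, ⟨c, σ, hc, hM⟩, U, hU, rfl⟩ := h
  have hU' : Uᴴ * U = 1 := Matrix.mem_unitaryGroup_iff'.1 hU
  have hG : (U * Φ * Mᴴ)ᴴ * (U * Φ * Mᴴ) = M * (Φᴴ * Φ) * Mᴴ := by
    simp only [Matrix.conjTranspose_mul, Matrix.conjTranspose_conjTranspose]
    calc M * (Φᴴ * Uᴴ) * (U * Φ * Mᴴ) = M * Φᴴ * (Uᴴ * U) * Φ * Mᴴ := by
          simp only [Matrix.mul_assoc]
      _ = _ := by rw [hU', Matrix.mul_one]; simp only [Matrix.mul_assoc]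
  have hent : ∀ a b, (M * (Φᴴ * Φ) * Mᴴ) a b = c a * star (c b) * (Φᴴ * Φ) (σ a) (σ b) := by
    intro a b
    rw [hM, Matrix.conjTranspose_mul, Matrix.conjTranspose_permMatrix,
      Matrix.diagonal_conjTranspose, Matrix.mul_assoc, Matrix.mul_assoc, Matrix.diagonal_mul,
      PEquiv.toMatrix_toPEquiv_mul, Matrix.submatrix_apply, ← Matrix.mul_assoc,
      Matrix.mul_diagonal, PEquiv.mul_toMatrix_toPEquiv, Matrix.submatrix_apply]
    simp [Equiv.Perm.inv_def]
    ring
  refine ⟨fun i => c (σ.symm i), σ.symm, fun k => hc _, fun i j => ?_⟩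
  rw [hG, hent]
  simp only [Equiv.apply_symm_apply]
  linear_combination (-(Φᴴ * Φ) i j) * (star_mul_self_of_norm_eq_one (hc (σ.symm i)))
    - (Φᴴ * Φ) i j * (star (c (σ.symm i)) * c (σ.symm i)) *
      (star_mul_self_of_norm_eq_one (hc (σ.symm j)))

theorem isETF_mul_diagonal_iff (hn : 1 ≤ n) {Φ : Matrix (Fin n) (Fin n ⊕ Fin n) ℂ}
    {c : Fin n ⊕ Fin n → ℂ} (hc : ∀ k, ‖c k‖ = 1) :
    IsETF (Φ * Matrix.diagonal c) ↔ IsETF Φ := by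
  have hG : ∀ i j, ((Φ * Matrix.diagonal c)ᴴ * (Φ * Matrix.diagonal c)) i j =
      star (c i) * c j * (Φᴴ * Φ) i j := fun i j => by
    rw [Matrix.conjTranspose_mul, Matrix.diagonal_conjTranspose, Matrix.mul_assoc,
      Matrix.diagonal_mul, ← Matrix.mul_assoc, Matrix.mul_diagonal]
    simp
    ring
  rw [isETF_iff hn, isETF_iff hn]
  simp only [hG, norm_mul, norm_star, hc, one_mul, star_mul_self_of_norm_eq_one (hc _)]

theorem isRegularConfig_mul_diagonal_iff {Φ : Matrix (Fin n) (Fin n ⊕ Fin n) ℂ}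
    {c : Fin n ⊕ Fin n → ℂ} (hc : ∀ k, ‖c k‖ = 1) :
    IsRegularConfig (Φ * Matrix.diagonal c) ↔ IsRegularConfig Φ := by
  have hG : ((Φ * Matrix.diagonal c)ᴴ * (Φ * Matrix.diagonal c)).toBlocks₁₁ =
      Matrix.diagonal (fun i => star (c (Sum.inl i))) * (Φᴴ * Φ).toBlocks₁₁ *
        Matrix.diagonal (fun i => c (Sum.inl i)) := by
    ext i j
    rw [Matrix.mul_diagonal, Matrix.diagonal_mul, Matrix.conjTranspose_mul,
      Matrix.diagonal_conjTranspose, Matrix.toBlocks₁₁, Matrix.of_apply, Matrix.mul_assoc,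
      Matrix.diagonal_mul, ← Matrix.mul_assoc, Matrix.mul_diagonal]
    simp [Matrix.toBlocks₁₁]
    ring
  have h0 : ∀ k, c k ≠ 0 := fun k => norm_ne_zero_iff.1 (by rw [hc]; exact one_ne_zero)
  rw [isRegularConfig_iff, isRegularConfig_iff, hG]
  simp only [Matrix.isUnit_iff_isUnit_det, Matrix.det_mul, Matrix.det_diagonal, isUnit_iff_ne_zero,
    ne_eq, mul_eq_zero, not_or, Finset.prod_eq_zero_iff, star_eq_zero, h0, and_false, exists_false,
    not_false_eq_true, true_and, and_true]

end Switching

/-! ### Skew Hadamard Gram matrices -/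

section SkewHadamard

variable {n : ℕ} {P Q : Matrix (Fin n) (Fin n) ℝ}

theorem Matrix.IsHadamard.four_dvd_card_real {m : Type*} [Fintype m] [DecidableEq m]
    {H : Matrix m m ℝ} (hH : H.IsHadamard) (hm : 2 < Fintype.card m) : 4 ∣ Fintype.card m := by
  have hpm : ∀ i j, H i j = 1 ∨ H i j = -1 := fun i j => by
    have := (Unitary.mem_iff.1 (hH.apply_mem i j)).1
    rw [star_trivial] at this
    exact mul_self_eq_one_iff.1 this
  choose f hf using fun i j => show ∃ k : ℤ, (k : ℝ) = H i j ∧ (k = 1 ∨ k = -1) by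
    rcases hpm i j with h | h
    · exact ⟨1, by simp [h], Or.inl rfl⟩
    · exact ⟨-1, by simp [h], Or.inr rfl⟩
  refine Matrix.IsHadamard.four_dvd_card (A := Matrix.of f) ?_ hm
  apply Matrix.IsHadamard.of_mul_conjTranspose
  · intro i j
    rw [Matrix.of_apply]
    rcases (hf i j).2 with h | h <;> rw [h] <;> simp [Unitary.mem_iff]
  · ext i j
    have := congrFun (congrFun hH.mul_conjTranspose i) j
    simp only [Matrix.mul_apply, Matrix.conjTranspose_apply, star_trivial, Matrix.smul_apply,
      Matrix.one_apply, smul_eq_mul, Matrix.of_apply, ← (hf _ _).1] at this ⊢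
    exact_mod_cast this
  · refine isRegular_iff_ne_zero.2 ?_
    exact_mod_cast (by omega : Fintype.card m ≠ 0)

theorem IsSkewHadamard.entries (hH : IsSkewHadamard (Matrix.fromBlocks P Q (-Qᵀ) Pᵀ)) :
    (∀ i, P i i = 1) ∧ (∀ i j, P i j = 1 ∨ P i j = -1) ∧ ∀ i j, Q i j = 1 ∨ Q i j = -1 := by
  have hpm : ∀ i j, Matrix.fromBlocks P Q (-Qᵀ) Pᵀ i j = 1 ∨
      Matrix.fromBlocks P Q (-Qᵀ) Pᵀ i j = -1 := fun i j => by
    have := (Unitary.mem_iff.1 (hH.1.apply_mem i j)).1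
    rw [star_trivial] at this
    exact mul_self_eq_one_iff.1 this
  refine ⟨fun i => ?_, fun i j => hpm (Sum.inl i) (Sum.inl j), fun i j => hpm (Sum.inl i) (Sum.inr j)⟩
  have := congrFun (congrFun hH.2 (Sum.inl i)) (Sum.inl i)
  simp at this
  linarith

/-- Off-diagonal entries of the Gram matrix are `1 / √(2n-1)` times a sign, times `i` if the
indices belong to the same block. -/
theorem exists_gramOfBlocks_apply_eq (hH : IsSkewHadamard (Matrix.fromBlocks P Q (-Qᵀ) Pᵀ)) :
    (∀ k, gramOfBlocks P Q k k = 1) ∧ ∃ e : Fin n ⊕ Fin n → Fin n ⊕ Fin n → ℝ,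
      (∀ k l, e k l = 1 ∨ e k l = -1) ∧ ∀ k l, k ≠ l → gramOfBlocks P Q k l =
        ((1 / Real.sqrt (2 * (n : ℝ) - 1) : ℝ) : ℂ) * e k l *
          if k.isLeft = l.isLeft then Complex.I else 1 := by
  obtain ⟨hd, hP, hQ⟩ := hH.entries
  constructor
  · rintro (i | i) <;> simp [gramOfBlocks, toComplex, hd]
  · refine ⟨fun k l => Matrix.fromBlocks P Q Qᵀ Pᵀ k l, ?_, ?_⟩
    · rintro (i | i) (j | j)
      · exact hP i j
      · exact hQ i j
      · exact hQ j i
      · exact hP j i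
    · rintro (i | i) (j | j) hij
      · have : i ≠ j := fun h => hij (by rw [h])
        simp [gramOfBlocks, toComplex, this]
        ring
      · simp [gramOfBlocks, toComplex]
      · simp [gramOfBlocks, toComplex]
      · have : i ≠ j := fun h => hij (by rw [h])
        simp [gramOfBlocks, toComplex, this]
        ring

theorem norm_gramOfBlocks_apply (hH : IsSkewHadamard (Matrix.fromBlocks P Q (-Qᵀ) Pᵀ))
    {k l : Fin n ⊕ Fin n} (hkl : k ≠ l) :
    ‖gramOfBlocks P Q k l‖ = 1 / Real.sqrt (2 * (n : ℝ) - 1) := by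
  obtain ⟨-, e, he, h⟩ := exists_gramOfBlocks_apply_eq hH
  have h1 : ‖(e k l : ℂ)‖ = 1 := by rcases he k l with h | h <;> simp [h]
  have h2 : ‖(if k.isLeft = l.isLeft then Complex.I else 1 : ℂ)‖ = 1 := by split_ifs <;> simp
  rw [h k l hkl, norm_mul, norm_mul, h1, h2, mul_one, mul_one, Complex.norm_real,
    Real.norm_of_nonneg (by positivity)]

/-- Among three indices spread over two blocks, one or three of the pairs share a block, so the
product is real times $i$ or $i^3$. -/
theorem triple_product_gramOfBlocks (hH : IsSkewHadamard (Matrix.fromBlocks P Q (-Qᵀ) Pᵀ))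
    {k l m : Fin n ⊕ Fin n} (hkl : k ≠ l) (hlm : l ≠ m) (hmk : m ≠ k) :
    (gramOfBlocks P Q k l * gramOfBlocks P Q l m * gramOfBlocks P Q m k).re = 0 := by
  obtain ⟨-, e, -, h⟩ := exists_gramOfBlocks_apply_eq hH
  rw [h k l hkl, h l m hlm, h m k hmk]
  cases hk : k.isLeft <;> cases hl : l.isLeft <;> cases hm : m.isLeft <;> simp

end SkewHadamard

/-! ### Nonsingular quasi-periodic Toeplitz matrices -/

section Nonsingular

variable {n : ℕ} {ε : ℝ} {f : ℤ → ℂ}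

theorem exists_injective_pow_eq (hn : 1 ≤ n) {a : ℂ} (ha : a ≠ 0) :
    ∃ z : Fin n → ℂ, Function.Injective z ∧ ∀ k, z k ^ n = a := by
  obtain ⟨β, hβ⟩ := IsAlgClosed.exists_pow_nat_eq a (by omega : 0 < n)
  have hβ0 : β ≠ 0 := by
    rintro rfl
    exact ha (by rw [← hβ, zero_pow (by omega)])
  have hζ := Complex.isPrimitiveRoot_exp n (by omega)
  set ζ := Complex.exp (2 * Real.pi * Complex.I / n)
  refine ⟨fun k => β * ζ ^ (k : ℕ), fun k l h => ?_, fun k => ?_⟩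
  · exact Fin.ext (hζ.pow_inj k.2 l.2 (mul_left_cancel₀ hβ0 h))
  · rw [mul_pow, hβ, ← pow_mul, mul_comm (k : ℕ), pow_mul, hζ.pow_eq_one, one_pow, mul_one]

/-- A quasi-periodic Toeplitz matrix is nonsingular if its eigenvalues, which are indexed by the
`n`-th roots of its multiplier, are nonzero. -/
theorem isUnit_toeplitz (hn : 1 ≤ n) (hε : ε * ε = 1) (hf : IsQuasiPeriodic n (ε : ℂ) f)
    (h : ∀ z : ℂ, z ^ n = ε → ∑ k : Fin n, f (k : ℤ) * z ^ (k : ℕ) ≠ 0) :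
    IsUnit (toeplitz n f) := by
  have hεC : (ε : ℂ) * ε = 1 := by exact_mod_cast hε
  have hε0 : (ε : ℂ) ≠ 0 := left_ne_zero_of_mul_eq_one hεC
  rw [Matrix.isUnit_iff_isUnit_det, isUnit_iff_ne_zero]
  intro hdet
  obtain ⟨x, hx0, hx⟩ := Matrix.exists_mulVec_eq_zero_iff.2 hdet
  obtain ⟨z, hz, hzn⟩ := exists_injective_pow_eq hn hε0
  have heval : ∀ w : ℂ, w ^ n = ε → ∑ j : Fin n, x j * w ^ (j : ℕ) = 0 := by
    intro w hw
    have hw0 : w ≠ 0 := by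
      rintro rfl
      rw [zero_pow (by omega)] at hw
      exact hε0 hw.symm
    -- The row $(w^i)_i$ is a left eigenvector, with eigenvalue the given sum at $w^{-1}$, again an
    -- $n$-th root of $\varepsilon$. A kernel vector $x$ is therefore orthogonal to $n$ independent
    -- rows, a Vandermonde matrix.
    have hrow : (fun i : Fin n => w ^ (i : ℕ)) ᵥ* toeplitz n f =
        (∑ k : Fin n, f (k : ℤ) * w⁻¹ ^ (k : ℕ)) • fun j : Fin n => w ^ (j : ℕ) := by
      funext j
      have hper : Function.Periodic (fun m : ℤ => w ^ m * f ((j : ℤ) - m)) (n : ℤ) := by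
        intro m
        have h2 : f ((j : ℤ) - m) = ε * f ((j : ℤ) - (m + n)) := by rw [← hf]; congr 1; ring
        simp only [h2, zpow_add₀ hw0, zpow_natCast, hw]
        ring
      have := sum_sub_eq_of_periodic hper (j : ℤ)
      simp only [zpow_natCast] at this
      rw [Matrix.vecMul, dotProduct, Pi.smul_apply, smul_eq_mul, Finset.sum_mul]
      simp only [toeplitz_apply]
      rw [← this]
      refine Finset.sum_congr rfl fun k _ => ?_
      rw [zpow_sub₀ hw0, zpow_natCast, zpow_natCast, inv_pow, sub_sub_cancel]
      field_simp
    have h1 : ((fun i : Fin n => w ^ (i : ℕ)) ᵥ* toeplitz n f) ⬝ᵥ x = 0 := by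
      rw [← Matrix.dotProduct_mulVec, hx, dotProduct_zero]
    rw [hrow, smul_dotProduct, smul_eq_mul] at h1
    have hinv : w⁻¹ ^ n = ε := by
      rw [inv_pow, hw]
      exact inv_eq_of_mul_eq_one_left hεC
    have h2 := (mul_eq_zero.1 h1).resolve_left (h _ hinv)
    rw [← h2, dotProduct]
    exact Finset.sum_congr rfl fun j _ => mul_comm _ _
  apply hx0
  have hV : (Matrix.vandermonde z) *ᵥ x = 0 := by
    funext k
    rw [Pi.zero_apply, ← heval (z k) (hzn k), Matrix.mulVec, dotProduct]
    exact Finset.sum_congr rfl fun j _ => by rw [Matrix.vandermonde_apply, mul_comm]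
  exact Matrix.eq_zero_of_mulVec_eq_zero (Matrix.det_vandermonde_ne_zero_iff.2 hz) hV

/-- Multiplied by $r=\sqrt{2n-1}$, an eigenvalue takes the form $r+ia$ with $a\in\mathbb Z[z]$ and
$z^{2n}=1$. If it vanished, then $a^2=-(2n-1)$, which is excluded since $n$ is even. -/
theorem isUnit_toeplitz_of_equiangular (hn : 1 ≤ n) (heven : Even n) (hε : ε * ε = 1)
    (hf : IsQuasiPeriodic n (ε : ℂ) f) (hf0 : f 0 = 1)
    (hre : ∀ k : Fin n, (k : ℕ) ≠ 0 → (f (k : ℤ)).re = 0)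
    (hnorm : ∀ k : Fin n, (k : ℕ) ≠ 0 → ‖f (k : ℤ)‖ = 1 / Real.sqrt (2 * (n : ℝ) - 1)) :
    IsUnit (toeplitz n f) := by
  have hn1 : (1 : ℝ) ≤ n := by exact_mod_cast hn
  have hpos : (0 : ℝ) < 2 * n - 1 := by linarith
  set r : ℝ := Real.sqrt (2 * (n : ℝ) - 1) with hr
  have hr0 : 0 < r := Real.sqrt_pos.2 hpos
  have hr2 : (r : ℂ) ^ 2 = 2 * n - 1 := by
    have : r ^ 2 = 2 * n - 1 := Real.sq_sqrt hpos.le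
    exact_mod_cast this
  have hrC : (r : ℂ) ≠ 0 := by exact_mod_cast hr0.ne'
  refine isUnit_toeplitz hn hε hf fun z hz h => ?_
  have hsign : ∀ k : Fin n, ∃ s : ℤ, r * f (k : ℤ) = (if (k : ℕ) = 0 then (r : ℂ) else 0) +
      Complex.I * s := by
    intro k
    by_cases hk : (k : ℕ) = 0
    · exact ⟨0, by simp [hk, hf0]⟩
    · have h1 : |(f (k : ℤ)).im| = 1 / r := by
        rw [← hnorm k hk]
        exact Complex.abs_im_eq_norm.2 (hre k hk)
      have h2 : f (k : ℤ) = Complex.I * (f (k : ℤ)).im := by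
        apply Complex.ext <;> simp [hre k hk]
      rcases eq_or_eq_neg_of_abs_eq h1 with h3 | h3
      · refine ⟨1, ?_⟩
        rw [h2, h3]
        simp [hk]
        field_simp
      · refine ⟨-1, ?_⟩
        rw [h2, h3]
        simp [hk]
        field_simp
  choose s hs using hsign
  have hz2 : z ^ (2 * n) = 1 := by
    rw [mul_comm, pow_mul, hz, sq]
    exact_mod_cast hε
  set a : ℂ := ∑ k : Fin n, (s k : ℂ) * z ^ (k : ℕ) with ha
  have hmem : a ∈ Algebra.adjoin ℤ {z} :=
    sum_mem fun k _ => mul_mem (intCast_mem _ _) (pow_mem (Algebra.self_mem_adjoin_singleton ℤ z) _)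
  have hsum : (r : ℂ) + Complex.I * a = 0 := by
    have h1 : ∑ k : Fin n, (if (k : ℕ) = 0 then (r : ℂ) else 0) * z ^ (k : ℕ) = r := by
      rw [Finset.sum_eq_single (⟨0, by omega⟩ : Fin n)]
      · simp
      · intro k _ hk
        rw [if_neg fun h => hk (Fin.ext h), zero_mul]
      · simp
    calc (r : ℂ) + Complex.I * a
        = ∑ k : Fin n, (r : ℂ) * (f (k : ℤ) * z ^ (k : ℕ)) := by
          rw [ha, Finset.mul_sum]
          nth_rewrite 1 [← h1]
          rw [← Finset.sum_add_distrib]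
          refine Finset.sum_congr rfl fun k _ => ?_
          rw [← mul_assoc (r : ℂ), hs k]
          ring
      _ = 0 := by rw [← Finset.mul_sum, h, mul_zero]
  refine sq_ne_neg_natCast_of_mem_adjoin (by omega : 0 < 2 * n) hz2 (2 * n - 1) ?_ ?_ a hmem ?_
  · rw [Nat.coprime_comm]
    have := Nat.coprime_self_sub_right (m := 1) (n := 2 * n) (by omega)
    exact this.2 (Nat.coprime_one_right _)
  · obtain ⟨m, rfl⟩ := heven
    omega
  · rw [Nat.cast_sub (by omega)]
    push_cast
    have h3 : a = Complex.I * r := by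
      linear_combination (-Complex.I) * hsum + a * Complex.I_sq
    rw [h3, mul_pow, Complex.I_sq, hr2]
    ring

end Nonsingular

/-! ### The characterization -/

section Main

variable {n : ℕ} {π : DihedralGroup n → Matrix.unitaryGroup (Fin n) ℂ} {ε : ℝ}
  {u t : Matrix.unitaryGroup (Fin n) ℂ} {v : EuclideanSpace ℂ (Fin n)}

theorem IsDihedralPair.exists_isSkewHadamard (hn : 1 ≤ n) (hε : ε * ε = 1)
    (h : IsDihedralPair π ε u t) (hv : ‖v‖ = 1) (hreg : IsRegularConfig (pairConfig u t v))
    (hetf : IsETF (pairConfig u t v)) :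
    ∃ s q : ℤ → ℝ, IsQuasiPeriodic n ε s ∧ IsQuasiPeriodic n ε q ∧
      IsSkewHadamard (Matrix.fromBlocks (1 + toeplitz n s) (toeplitz n q)
        (-(toeplitz n q)ᵀ) (1 + toeplitz n s)ᵀ) ∧
      (pairConfig u t v)ᴴ * pairConfig u t v =
        gramOfBlocks (1 + toeplitz n s) (toeplitz n q) := by
  have hG := h.gram_eq (v := v)
  have hf : IsQuasiPeriodic n (ε : ℂ) fun m => coeff v (u ^ m) := by
    simpa using h.isQuasiPeriodic (v := v) 1
  have hg := h.isQuasiPeriodic (v := v) t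
  have hB := hetf.mul_conjTranspose hn
  have hGG : (pairConfig u t v)ᴴ * pairConfig u t v * ((pairConfig u t v)ᴴ * pairConfig u t v) =
      (2 : ℂ) • ((pairConfig u t v)ᴴ * pairConfig u t v) := by
    rw [Matrix.mul_assoc, ← Matrix.mul_assoc (pairConfig u t v), hB]
    simp
  have hnorm := ((isETF_iff hn).1 hetf).2
  rw [isRegularConfig_iff] at hreg
  rw [hG] at hnorm hGG hreg ⊢
  rw [Matrix.fromBlocks_multiply, Matrix.fromBlocks_smul, Matrix.fromBlocks_inj] at hGG
  exact exists_isSkewHadamard_of_toeplitz_gram hn hε hf hg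
    (fun m => by rw [zpow_neg, coeff_inv]) h.coeff_mul_im (by simp [coeff_one hv])
    (fun i j hij => hnorm (Sum.inl i) (Sum.inl j) (by simpa using hij))
    (fun i j => hnorm (Sum.inl i) (Sum.inr j) (by simp)) hGG.1 hGG.2.1 hreg

theorem isETF_of_switchingEquiv (hn : 1 ≤ n) {Φ Ψ : Matrix (Fin n) (Fin n ⊕ Fin n) ℂ}
    {P Q : Matrix (Fin n) (Fin n) ℝ} (hH : IsSkewHadamard (Matrix.fromBlocks P Q (-Qᵀ) Pᵀ))
    (hs : SwitchingEquiv Φ Ψ) (hΨ : Ψᴴ * Ψ = gramOfBlocks P Q) : IsETF Φ := by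
  obtain ⟨c, σ, hc, hG⟩ := hs.exists_gram_apply
  rw [hΨ] at hG
  refine (isETF_iff hn).2 ⟨fun k => ?_, fun k l hkl => ?_⟩
  · rw [hG, (exists_gramOfBlocks_apply_eq hH).1, mul_one, star_mul_self_of_norm_eq_one (hc k)]
  · rw [hG, norm_mul, norm_mul, norm_star, hc, hc, one_mul, one_mul,
      norm_gramOfBlocks_apply hH (σ.injective.ne hkl)]

theorem re_triple_product_of_switchingEquiv {Φ Ψ : Matrix (Fin n) (Fin n ⊕ Fin n) ℂ}
    {P Q : Matrix (Fin n) (Fin n) ℝ} (hH : IsSkewHadamard (Matrix.fromBlocks P Q (-Qᵀ) Pᵀ))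
    (hs : SwitchingEquiv Φ Ψ) (hΨ : Ψᴴ * Ψ = gramOfBlocks P Q) {k l m : Fin n ⊕ Fin n}
    (hkl : k ≠ l) (hlm : l ≠ m) (hmk : m ≠ k) :
    ((Φᴴ * Φ) k l * (Φᴴ * Φ) l m * (Φᴴ * Φ) m k).re = 0 := by
  obtain ⟨c, σ, hc, hG⟩ := hs.exists_gram_apply
  rw [hΨ] at hG
  rw [hG, hG, hG, ← triple_product_gramOfBlocks hH (σ.injective.ne hkl) (σ.injective.ne hlm)
    (σ.injective.ne hmk)]
  congr 1
  have hk := star_mul_self_of_norm_eq_one (hc k)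
  have hl := star_mul_self_of_norm_eq_one (hc l)
  have hm := star_mul_self_of_norm_eq_one (hc m)
  calc _ = (star (c k) * c k) * (star (c l) * c l) * (star (c m) * c m) *
        (gramOfBlocks P Q (σ k) (σ l) * gramOfBlocks P Q (σ l) (σ m) *
          gramOfBlocks P Q (σ m) (σ k)) := by ring
    _ = _ := by rw [hk, hl, hm, one_mul, one_mul, one_mul]

/-- The permutation in the switching need not respect the two halves of the columns, so
invertibility must be read off from switching invariants of the configuration itself. -/
theorem IsDihedralPair.isRegularConfig_of_switchingEquiv (hn : 1 ≤ n) (hε : ε * ε = 1)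
    (h : IsDihedralPair π ε u t) (hv : ‖v‖ = 1) {Ψ : Matrix (Fin n) (Fin n ⊕ Fin n) ℂ}
    {P Q : Matrix (Fin n) (Fin n) ℝ} (hH : IsSkewHadamard (Matrix.fromBlocks P Q (-Qᵀ) Pᵀ))
    (hs : SwitchingEquiv (pairConfig u t v) Ψ) (hΨ : Ψᴴ * Ψ = gramOfBlocks P Q) :
    IsRegularConfig (pairConfig u t v) := by
  have : NeZero n := ⟨by omega⟩
  have hG := h.gram_eq (v := v)
  have hnorm := ((isETF_iff hn).1 (isETF_of_switchingEquiv hn hH hs hΨ)).2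
  have htriple := fun k l m => re_triple_product_of_switchingEquiv hH hs hΨ (k := k) (l := l) (m := m)
  rw [isRegularConfig_iff]
  rw [hG] at hnorm htriple ⊢
  rw [Matrix.toBlocks_fromBlocks₁₁]
  have hf : IsQuasiPeriodic n (ε : ℂ) fun m => coeff v (u ^ m) := by
    simpa using h.isQuasiPeriodic (v := v) 1
  have hf0 : coeff v (u ^ (0 : ℤ)) = 1 := by simp [coeff_one hv]
  rcases Nat.lt_or_ge 1 n with hn2 | hn2
  · have h4 := hH.1.four_dvd_card_real (by simp; omega)
    have heven : Even n := by
      rw [Fintype.card_sum, Fintype.card_fin] at h4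
      rw [Nat.even_iff]
      omega
    have hn1 : (1 : ℝ) ≤ n := by exact_mod_cast hn
    have hpos : 0 < 1 / Real.sqrt (2 * (n : ℝ) - 1) := by
      have : (0 : ℝ) < 2 * n - 1 := by linarith
      positivity
    refine isUnit_toeplitz_of_equiangular hn heven hε hf hf0 (fun k hk => ?_) (fun k hk => ?_)
    · have hk0 : (0 : Fin n) ≠ k := fun h => hk (by rw [← h]; rfl)
      -- For the triple $1,\mu^k,\tau$ the triple product is $f(k)$ times two nonzero real numbers,
      -- so $f(k)$ is imaginary.
      have h3 := htriple (Sum.inl 0) (Sum.inl k) (Sum.inr 0) (by simpa using hk0) (by simp) (by simp)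
      have hne : ∀ i, (coeff v (u ^ (((0 : Fin n) : ℤ) - ((i : Fin n) : ℤ)) * t)).re ≠ 0 := by
        intro i h0
        have h5 := hnorm (Sum.inl i) (Sum.inr 0) (by simp)
        have h6 : coeff v (u ^ (((0 : Fin n) : ℤ) - ((i : Fin n) : ℤ)) * t) = 0 :=
          Complex.ext h0 (h.coeff_mul_im _)
        rw [Matrix.fromBlocks_apply₁₂, toeplitz_apply, h6, norm_zero] at h5
        exact hpos.ne h5
      simp only [Matrix.fromBlocks_apply₁₁, Matrix.fromBlocks_apply₁₂, Matrix.fromBlocks_apply₂₁,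
        Matrix.transpose_apply, toeplitz_apply, Complex.mul_re, Complex.mul_im, h.coeff_mul_im,
        mul_zero, sub_zero, zero_add, mul_eq_zero, hne, or_false] at h3
      simpa using h3
    · have hk0 : (0 : Fin n) ≠ k := fun h => hk (by rw [← h]; rfl)
      have h3 := hnorm (Sum.inl 0) (Sum.inl k) (by simpa using hk0)
      simpa [toeplitz_apply] using h3
  · obtain rfl : n = 1 := by omega
    have h1 : toeplitz 1 (fun m => coeff v (u ^ m)) = 1 := by
      ext i j
      rw [Subsingleton.elim i j, toeplitz_apply, sub_self, hf0, Matrix.one_apply_eq]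
    rw [h1]
    exact isUnit_one

/-- The predicate `C` stands for circulant or negacirculant, so that both values of $\varepsilon$
are treated at once. -/
theorem IsDihedralPair.regular_etf_iff (hn : 1 ≤ n) (hε : ε * ε = 1) (hπ : IsProjRep π)
    (h : IsDihedralPair π ε u t) (hv : ‖v‖ = 1) {C : Matrix (Fin n) (Fin n) ℝ → Prop}
    (hC : ∀ s, IsQuasiPeriodic n ε s → C (toeplitz n s))
    (hC' : ∀ s, IsQuasiPeriodic n ε s → C (1 + toeplitz n s)) :
    (IsRegularConfig (dihedralConfig π v) ∧ IsETF (dihedralConfig π v)) ↔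
      ∃ P Q : Matrix (Fin n) (Fin n) ℝ, C P ∧ C Q ∧
        IsSkewHadamard (Matrix.fromBlocks P Q (-Qᵀ) Pᵀ) ∧
        ∃ Ψ : Matrix (Fin n) (Fin n ⊕ Fin n) ℂ,
          SwitchingEquiv (dihedralConfig π v) Ψ ∧ Ψᴴ * Ψ = gramOfBlocks P Q := by
  obtain ⟨c, hc, hΦ⟩ := h.exists_phases hπ v
  rw [hΦ, isRegularConfig_mul_diagonal_iff hc, isETF_mul_diagonal_iff hn hc]
  constructor
  · rintro ⟨hreg, hetf⟩
    obtain ⟨s, q, hs, hq, hH, hG⟩ := h.exists_isSkewHadamard hn hε hv hreg hetf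
    exact ⟨_, _, hC' s hs, hC q hq, hH, _, switchingEquiv_mul_diagonal _ hc, hG⟩
  · rintro ⟨P, Q, -, -, hH, Ψ, hs, hΨ⟩
    have hs' := hs.of_mul_diagonal hc
    exact ⟨h.isRegularConfig_of_switchingEquiv hn hε hv hH hs' hΨ,
      isETF_of_switchingEquiv hn hH hs' hΨ⟩

end Main

theorem theorem4 (n : ℕ) (hn : 1 ≤ n)
    (π : DihedralGroup n → Matrix.unitaryGroup (Fin n) ℂ) (hπ : IsProjRep π)
    (v : EuclideanSpace ℂ (Fin n)) (hv : ‖v‖ = 1) :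
    (IsEquivStrict π →
      ((IsRegularConfig (dihedralConfig π v) ∧ IsETF (dihedralConfig π v)) ↔
        ∃ P Q : Matrix (Fin n) (Fin n) ℝ, IsCirculant P ∧ IsCirculant Q ∧
          IsSkewHadamard (Matrix.fromBlocks P Q (-Qᵀ) Pᵀ) ∧
          ∃ Ψ : Matrix (Fin n) (Fin n ⊕ Fin n) ℂ,
            SwitchingEquiv (dihedralConfig π v) Ψ ∧ Ψᴴ * Ψ = gramOfBlocks P Q)) ∧
    (¬ IsEquivStrict π →
      ((IsRegularConfig (dihedralConfig π v) ∧ IsETF (dihedralConfig π v)) ↔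
        ∃ P Q : Matrix (Fin n) (Fin n) ℝ, IsNegacirculant P ∧ IsNegacirculant Q ∧
          IsSkewHadamard (Matrix.fromBlocks P Q (-Qᵀ) Pᵀ) ∧
          ∃ Ψ : Matrix (Fin n) (Fin n ⊕ Fin n) ℂ,
            SwitchingEquiv (dihedralConfig π v) Ψ ∧ Ψᴴ * Ψ = gramOfBlocks P Q)) := by
  constructor
  · intro h
    obtain ⟨u, t, hut⟩ := h.exists_isDihedralPair
    exact hut.regular_etf_iff hn (by norm_num) hπ hv (fun _ => isCirculant_toeplitz hn)
      (fun _ => isCirculant_one_add_toeplitz hn)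
  · intro h
    obtain ⟨ε, u, t, hε | hε, hut⟩ := hπ.exists_isDihedralPair hn
    · subst hε
      exact absurd (isEquivStrict_of_isDihedralPair hn hπ hut) h
    · subst hε
      exact hut.regular_etf_iff hn (by norm_num) hπ hv (fun _ => isNegacirculant_toeplitz)
        (fun _ => isNegacirculant_one_add_toeplitz hn)
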